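/- All differential fields are of characteristic $0$, with one derivation $a\mapsto a'$, and an extension of differential fields is always assumed to have the same field of constants as the base field. Let $K$ be a differential field and let $$L=a_nD^n+\dots+a_1D+a_0,\qquad a_i\in K,\ a_n\neq 0,$$ be a linear differential operator of order $n$ over $K$. An element $y$ of an extension of a differential field $M$ is a *special transcendental element over $M$* if $y$ is transcendental over $M$ and $y'=\frac{yP(y)}{Q(y)}$ for some polynomials $P,Q\in M[X]$ such that $XP$ and $Q$ are relatively prime. An extension $E\supset K$ is *admissible* if there is a chain $K=K_0\subset K_1\subset\dots\subset K_m=E$ in which each $K_{i+1}=K_i\langle y_i\rangle$ is the differential field generated over $K_i$ by a special transcendental element $y_i$ over $K_i$. *All solutions of $L(y)=0$ belong to $E$* means that $E$ contains $n$ solutions that are linearly independent over the constants and that every solution in any extension of $E$ (with the same constants) lies in $E$. **Theorem.** There is an admissible extension $E\supset K$ to which all solutions of $L(y)=0$ belong if and only if there are elements $p_1,\dots,p_n\in K$ and nonzero elements $z_1,\dots,z_n$ of some extension $F\supset K$ (with the same constants) with $z_i'=p_iz_i$ for all $i$, such that the following two conditions hold simultaneously: 1. $L=a_n\,(D-p_n)\circ\dots\circ(D-p_1)$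 as differential operators over $K$; 2. if $G\subset F^*$ is the multiplicative group generated by $z_1,\dots,z_n$ and $G_0=G\cap K$, then the factor group $G/G_0$ is torsion free. -/

import Mathlib

open Polynomial
open scoped Differential

universe u

namespace DiffField

section Operators

variable {K : Type u} [Field K] [Differential K]

/-- The field of constants of a differential field. -/
def constants (K : Type u) [Field K] [Differential K] : Subfield K where
  carrier := {c | c′ = 0}
  mul_mem' {a b} ha hb := by
    have ha' : a′ = 0 := ha
    have hb' : b′ = 0 := hb
    simp [Derivation.leibniz, ha', hb']
  one_mem' := by simp
  add_mem' {a b} ha hb := by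
    have ha' : a′ = 0 := ha
    have hb' : b′ = 0 := hb
    simp [ha', hb']
  zero_mem' := by simp
  neg_mem' {a} ha := by
    have ha' : a′ = 0 := ha
    simp [ha']
  inv_mem' a ha := by
    have ha' : a′ = 0 := ha
    simp [Derivation.leibniz_inv, ha']

/-- Linear differential operators `a_n D^n + ⋯ + a_0` over `K`, stored by their coefficients:
the polynomial variable `X` stands for `D`, and the coefficients stand on the left of the powers
of `D`.  The product of operators is `DiffOp.comp`, not the product of polynomials. -/
abbrev DiffOp (K : Type u) [Field K] := K[X]

/-- The operator `D ∘ M`.  As `D ∘ b D^j = b D^(j+1) + b′ D^j`, it is obtained from `M` by raising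
all exponents by one and adding `M` with differentiated coefficients. -/
noncomputable def DiffOp.derivComp (M : DiffOp K) : DiffOp K :=
  X * M + Differential.mapCoeffs M

/-- The product `L ∘ M` of operators: if `L = ∑ a_i D^i`, it is `∑ a_i (D^i ∘ M)`. -/
noncomputable def DiffOp.comp (L M : DiffOp K) : DiffOp K :=
  L.sum fun i a => C a * DiffOp.derivComp^[i] M

/-- The product `(D - p_n) ∘ ⋯ ∘ (D - p_1)`, where `p_i` is written `p (i - 1)`. -/
noncomputable def DiffOp.prodLinear {n : ℕ} (p : Fin n → K) : DiffOp K :=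
  (List.ofFn p).foldl (fun M q => DiffOp.comp (X - C q) M) 1

/-- The value `L(y) = a_n y^(n) + ⋯ + a_0 y` at an element `y` of an extension `F` of `K`. -/
noncomputable def DiffOp.apply {F : Type u} [Field F] [Differential F] [Algebra K F]
    (L : DiffOp K) (y : F) : F :=
  L.sum fun i a => algebraMap K F a * (fun x : F => x′)^[i] y

end Operators

section Extensions

/-- `y` is a special transcendental element over `K`: it is transcendental over `K` and
`y′ = R(y)` for a rational function `R = X P / Q` over `K` with `X P` and `Q` relatively prime. -/
def IsSpecialTranscendental (K : Type*) {E : Type*} [Field K] [Field E] [Differential E]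
    [Algebra K E] (y : E) : Prop :=
  Transcendental K y ∧
    ∃ P Q : K[X], IsCoprime (X * P) Q ∧ y′ = aeval y (X * P) / aeval y Q

variable (K : Type u) [Field K] [Differential K]
variable (E : Type u) [Field E] [Differential E] [Algebra K E]

variable {K E} in
/-- `M⟨y⟩`: the smallest subfield of `E` that contains `M` and `y` and is closed under
differentiation. -/
def diffAdjoin (M : IntermediateField K E) (y : E) : IntermediateField K E :=
  sInf {N | M ≤ N ∧ y ∈ N ∧ ∀ x ∈ N, x′ ∈ N}

/-- `E` is an admissible extension of `K`: there is a chain `K = K_0 ⊆ ⋯ ⊆ K_m = E` in which each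
`K_(i+1)` is obtained by adjoining to `K_i` a special transcendental element over `K_i`. -/
def IsAdmissible : Prop :=
  ∃ (m : ℕ) (M : Fin (m + 1) → IntermediateField K E),
    M 0 = ⊥ ∧ M (Fin.last m) = ⊤ ∧
      ∀ i : Fin m, ∃ y : E, IsSpecialTranscendental (M i.castSucc) y ∧
        M i.succ = diffAdjoin (M i.castSucc) y

variable {K}

/-- All solutions of the equation `L(y) = 0` of order `n` belong to `E`: the solutions in `E`
include `n` ones that are linearly independent over the constants (so none are missing), and any
solution in any extension `F` of `E` with the same constants lies in `E`. -/
def ContainsAllSolutions (n : ℕ) (L : DiffOp K) : Prop :=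
  (∃ v : Fin n → E, LinearIndependent (constants K) v ∧ ∀ i, L.apply (v i) = 0) ∧
    ∀ (F : Type u) [Field F] [Differential F] [Algebra E F] [Algebra K F] [IsScalarTower K E F]
      [DifferentialAlgebra E F] [Differential.ContainConstants E F] (y : F),
      L.apply y = 0 → y ∈ (algebraMap E F).range

/-- For `z_1, …, z_n` in the multiplicative group of an extension `F` of `K`, let `G` be the group
that they generate and `G_0 = G ∩ K`; the quotient `G / G_0` is torsion free. -/
def TorsionFreeModBase {F : Type u} [Field F] [Algebra K F] {n : ℕ} (z : Fin n → Fˣ) : Prop :=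
  IsMulTorsionFree
    (Subgroup.closure (Set.range z) ⧸
      (Units.map (algebraMap K F : K →* F)).range.subgroupOf (Subgroup.closure (Set.range z)))

end Extensions

end DiffField

/-!
A solvability criterion for linear differential equations by special transcendental elements.

Let `y` be special over `M`, so that `y′ = y P(y) / Q(y)` with `Q(0) ≠ 0`. The derivation of `M(y)`
preserves the valuation ring of the place `y = 0` and its maximal ideal, so that the residue map at
this place (`HasResidue`) commutes with differentiation (`HasResidue.deriv`). Two facts about an
admissible extension `E` of `K` follow by descent along its chain.

* If `f ≠ 0` is a solution of `L(y) = 0` in `E`, then `q = f′ / f` satisfies the Riccati equation of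
  `L`. A solution of this equation has no pole at `y = 0`, because at a pole the powers `q ^ i`
  dominate the other terms (`HasResidue.riccati_inv_ne_zero`), and its residue is again a solution.
  So the Riccati equation has a solution `q₀` in `K` (`IsAdmissible.exists_riccati_eq_zero`), which
  means that `D - q₀` divides `L` on the right. If all solutions lie in `E`, then counting
  dimensions over the constants shows that `D - q₀` has a nonzero solution in `E` and that the
  other factor has all its solutions in `E`; so `L` factors completely, with all `z_i` in `E`
  (`IsAdmissible.exists_factorization`).
* If `z ∈ E` has a power in `K`, then `z` divided by its residue is a root of unity, hence a
  constant, and so `z ∈ K` (`IsAdmissible.mem_range_of_pow_eq`). This gives the torsion-freeness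
  for any choice of the `z_i` in `E`.

Conversely, let a factorization and the `z_i` be given. A basis `w_1, …, w_r` of the free group
`G / G_0` consists of exponentials without multiplicative relations modulo `K`; these are
algebraically independent over `K` (`algebraicIndependent_of_exponentials`), so that each `w_j` is
special over the field generated by its predecessors, and together with `K` they generate all
`z_i`. The solutions of `L(y) = 0` are then found by successive integrations. An integral `x` either
lies in the field already or is transcendental over it, and in the second case `1 / x` is special,
since `(1 / x)′ = -x′ (1 / x) ^ 2`. A field without new constants that contains the necessary
integrals is constructed first (`exists_extension_solutions`), and the admissible tower is then
formed inside it (`AdmissibleIn`).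
-/

namespace DiffField

/-! ### The ring of differential operators -/

section Operators

variable {K : Type u} [Field K] [Differential K]

namespace DiffOp

lemma derivComp_add (M N : DiffOp K) : derivComp (M + N) = derivComp M + derivComp N := by
  simp only [derivComp, map_add, mul_add]; ring

lemma derivComp_C_mul (a : K) (M : DiffOp K) :
    derivComp (C a * M) = C a * derivComp M + C a′ * M := by
  simp only [derivComp, Derivation.leibniz, smul_eq_mul, Differential.mapCoeffs_C]; ring

lemma derivComp_iterate_one (i : ℕ) : derivComp^[i] (1 : DiffOp K) = X ^ i := by
  induction i with
  | zero => rfl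
  | succ i ih =>
    rw [Function.iterate_succ_apply', ih, derivComp, Derivation.leibniz_pow]
    simp [pow_succ']

lemma add_comp (L M N : DiffOp K) : comp (L + M) N = comp L N + comp M N :=
  sum_add_index _ _ _ (by simp) (by intros; rw [map_add, add_mul])

lemma zero_comp (N : DiffOp K) : comp 0 N = 0 := by simp [comp]

lemma comp_one (L : DiffOp K) : comp L 1 = L := by
  simp only [comp, derivComp_iterate_one]
  exact L.sum_C_mul_X_pow_eq

lemma monomial_comp (i : ℕ) (a : K) (N : DiffOp K) :
    comp (monomial i a) N = C a * derivComp^[i] N := by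
  simp [comp, sum_monomial_index]

lemma C_comp (a : K) (N : DiffOp K) : comp (C a) N = C a * N := by
  simpa using monomial_comp 0 a N

lemma one_comp (N : DiffOp K) : comp 1 N = N := by
  simpa using C_comp 1 N

lemma C_mul_comp (a : K) (L M : DiffOp K) : comp (C a * L) M = C a * comp L M := by
  induction L using Polynomial.induction_on' with
  | add p q hp hq => simp only [mul_add, add_comp, hp, hq]
  | monomial n b => simp only [C_mul_monomial, monomial_comp, C_mul, mul_assoc]

lemma derivComp_monomial (i : ℕ) (a : K) :
    derivComp (monomial i a) = monomial (i + 1) a + monomial i a′ := by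
  simp [derivComp, X_mul_monomial]

lemma derivComp_comp (L M : DiffOp K) : comp (derivComp L) M = derivComp (comp L M) := by
  induction L using Polynomial.induction_on' with
  | add p q hp hq => simp only [derivComp_add, add_comp, hp, hq]
  | monomial n b =>
    rw [derivComp_monomial, add_comp, monomial_comp, monomial_comp, monomial_comp,
      derivComp_C_mul, Function.iterate_succ_apply']

lemma derivComp_iterate_comp (i : ℕ) (L M : DiffOp K) :
    comp (derivComp^[i] L) M = derivComp^[i] (comp L M) := by
  induction i with
  | zero => rfl
  | succ i ih => rw [Function.iterate_succ_apply', Function.iterate_succ_apply',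
      derivComp_comp, ih]

lemma comp_assoc (L M N : DiffOp K) : comp (comp L M) N = comp L (comp M N) := by
  induction L using Polynomial.induction_on' with
  | add p q hp hq => simp only [add_comp, hp, hq]
  | monomial n b => simp only [monomial_comp, C_mul_comp, derivComp_iterate_comp]

/-! ### Degrees of products -/

lemma natDegree_derivComp_le (M : DiffOp K) : (derivComp M).natDegree ≤ M.natDegree + 1 := by
  rw [natDegree_le_iff_coeff_eq_zero]
  intro N hN
  obtain ⟨k, rfl⟩ : ∃ k, N = k + 1 := ⟨N - 1, by omega⟩
  simp [derivComp, coeff_X_mul, coeff_eq_zero_of_natDegree_lt (show M.natDegree < k by omega),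
    coeff_eq_zero_of_natDegree_lt (show M.natDegree < k + 1 by omega)]

lemma natDegree_derivComp_iterate_le (i : ℕ) (M : DiffOp K) :
    (derivComp^[i] M).natDegree ≤ i + M.natDegree := by
  induction i with
  | zero => simp
  | succ i ih =>
    rw [Function.iterate_succ_apply']
    have := natDegree_derivComp_le (derivComp^[i] M)
    omega

lemma coeff_derivComp_iterate (i : ℕ) (M : DiffOp K) :
    (derivComp^[i] M).coeff (i + M.natDegree) = M.leadingCoeff := by
  induction i with
  | zero => simp
  | succ i ih =>
    rw [Function.iterate_succ_apply', show i + 1 + M.natDegree = i + M.natDegree + 1 by ring,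
      derivComp, coeff_add, coeff_X_mul, ih, Differential.coeff_mapCoeffs,
      coeff_eq_zero_of_natDegree_lt]
    · simp
    · have := natDegree_derivComp_iterate_le i M
      omega

lemma natDegree_comp_le (L M : DiffOp K) :
    (comp L M).natDegree ≤ L.natDegree + M.natDegree := by
  refine natDegree_sum_le_of_forall_le _ _ fun i hi => ?_
  have h1 := natDegree_derivComp_iterate_le i M
  have h2 := le_natDegree_of_mem_supp i hi
  exact (natDegree_C_mul_le (L.coeff i) (derivComp^[i] M)).trans (by omega)

lemma coeff_comp (L M : DiffOp K) :
    (comp L M).coeff (L.natDegree + M.natDegree) = L.leadingCoeff * M.leadingCoeff := by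
  rw [comp, Polynomial.sum, finsetSum_coeff, Finset.sum_eq_single L.natDegree]
  · rw [coeff_C_mul, coeff_derivComp_iterate]; rfl
  · intro i hi hne
    have h1 := natDegree_derivComp_iterate_le i M
    have h3 := le_natDegree_of_mem_supp i hi
    rw [coeff_C_mul, coeff_eq_zero_of_natDegree_lt (p := derivComp^[i] M) (by omega), mul_zero]
  · intro h
    simp [notMem_support_iff.mp h]

lemma natDegree_comp {L M : DiffOp K} (hL : L ≠ 0) (hM : M ≠ 0) :
    (comp L M).natDegree = L.natDegree + M.natDegree := by
  refine natDegree_eq_of_le_of_coeff_ne_zero (natDegree_comp_le L M) ?_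
  rw [coeff_comp]
  exact mul_ne_zero (by simpa) (by simpa)

lemma leadingCoeff_comp {L M : DiffOp K} (hL : L ≠ 0) (hM : M ≠ 0) :
    (comp L M).leadingCoeff = L.leadingCoeff * M.leadingCoeff := by
  rw [leadingCoeff, natDegree_comp hL hM, coeff_comp]

end DiffOp

end Operators

/-! ### The action on extensions -/

namespace DiffOp

section Apply

variable {K : Type u} [Field K] {F : Type u} [Field F] [Differential F] [Algebra K F]

lemma iterate_deriv_add (i : ℕ) (x y : F) :
    (fun x : F => x′)^[i] (x + y) = (fun x : F => x′)^[i] x + (fun x : F => x′)^[i] y := by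
  induction i generalizing x y with
  | zero => rfl
  | succ i ih => simp only [Function.iterate_succ_apply, map_add, ih]

lemma iterate_deriv_const_mul (i : ℕ) {c : F} (hc : c′ = 0) (y : F) :
    (fun x : F => x′)^[i] (c * y) = c * (fun x : F => x′)^[i] y := by
  induction i generalizing y with
  | zero => rfl
  | succ i ih =>
    simp only [Function.iterate_succ_apply, Derivation.leibniz, smul_eq_mul, hc, mul_zero,
      add_zero, ih]

lemma apply_monomial (i : ℕ) (a : K) (y : F) :
    DiffOp.apply (monomial i a : DiffOp K) y = algebraMap K F a * (fun x : F => x′)^[i] y := by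
  simp [apply, sum_monomial_index]

lemma add_apply (L M : DiffOp K) (y : F) : DiffOp.apply (L + M) y = L.apply y + M.apply y :=
  sum_add_index _ _ _ (by simp) (by intros; rw [map_add, add_mul])

lemma apply_add (L : DiffOp K) (x y : F) : L.apply (x + y) = L.apply x + L.apply y := by
  simp only [apply, Polynomial.sum, iterate_deriv_add, mul_add, Finset.sum_add_distrib]

lemma apply_const_mul (L : DiffOp K) {c : F} (hc : c′ = 0) (y : F) :
    L.apply (c * y) = c * L.apply y := by
  simp only [apply, Polynomial.sum, iterate_deriv_const_mul _ hc, Finset.mul_sum]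
  exact Finset.sum_congr rfl fun _ _ => by ring

lemma apply_zero (L : DiffOp K) : L.apply (0 : F) = 0 := by
  simpa using apply_const_mul L (c := (0 : F)) (by simp) 0

lemma zero_apply (y : F) : DiffOp.apply (0 : DiffOp K) y = 0 := by simp [apply]

lemma C_apply (a : K) (y : F) : DiffOp.apply (C a : DiffOp K) y = algebraMap K F a * y := by
  simpa using apply_monomial 0 a y

lemma one_apply (y : F) : DiffOp.apply (1 : DiffOp K) y = y := by
  simpa using C_apply (1 : K) y

lemma C_mul_apply (a : K) (L : DiffOp K) (y : F) :
    DiffOp.apply (C a * L) y = algebraMap K F a * L.apply y := by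
  induction L using Polynomial.induction_on' with
  | add p q hp hq => simp only [mul_add, add_apply, hp, hq]
  | monomial n b => simp only [C_mul_monomial, apply_monomial, map_mul, mul_assoc]

lemma X_sub_C_apply (q : K) (y : F) :
    DiffOp.apply (X - C q : DiffOp K) y = y′ - algebraMap K F q * y := by
  rw [sub_eq_add_neg, ← C_neg, add_apply, C_apply, ← monomial_one_one_eq_X, apply_monomial]
  simp [sub_eq_add_neg]

variable [Differential K] [DifferentialAlgebra K F]

lemma derivComp_apply (L : DiffOp K) (y : F) : (derivComp L).apply y = (L.apply y)′ := by
  induction L using Polynomial.induction_on' with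
  | add p q hp hq => simp only [derivComp_add, add_apply, map_add, hp, hq]
  | monomial n b =>
    rw [derivComp_monomial, add_apply]
    simp only [apply_monomial, Derivation.leibniz, smul_eq_mul, deriv_algebraMap,
      Function.iterate_succ_apply']
    ring

lemma derivComp_iterate_apply (i : ℕ) (L : DiffOp K) (y : F) :
    (derivComp^[i] L).apply y = (fun x : F => x′)^[i] (L.apply y) := by
  induction i with
  | zero => rfl
  | succ i ih => rw [Function.iterate_succ_apply', Function.iterate_succ_apply',
      derivComp_apply, ih]

lemma comp_apply (L M : DiffOp K) (y : F) : (comp L M).apply y = L.apply (M.apply y) := by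
  induction L using Polynomial.induction_on' with
  | add p q hp hq => simp only [add_comp, add_apply, hp, hq]
  | monomial n b =>
    rw [monomial_comp, C_mul_apply, derivComp_iterate_apply, apply_monomial]

end Apply

section Tower

variable {K : Type u} [Field K] {F : Type u} [Field F] [Algebra K F]
variable {E : Type u} [Field E] [Differential E] [Algebra F E] [Algebra K E] [IsScalarTower K F E]

lemma apply_map (L : DiffOp K) (y : E) :
    DiffOp.apply (K := F) (L.map (algebraMap K F)) y = L.apply y := by
  induction L using Polynomial.induction_on' with
  | add p q hp hq => simp only [Polynomial.map_add, add_apply, hp, hq]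
  | monomial n b =>
    rw [map_monomial, apply_monomial, apply_monomial, ← IsScalarTower.algebraMap_apply]

lemma iterate_deriv_algebraMap [Differential F] [DifferentialAlgebra F E] (i : ℕ) (y : F) :
    (fun x : E => x′)^[i] (algebraMap F E y) = algebraMap F E ((fun x : F => x′)^[i] y) := by
  induction i generalizing y with
  | zero => rfl
  | succ i ih => simp only [Function.iterate_succ_apply, deriv_algebraMap, ih]

lemma apply_algebraMap [Differential F] [DifferentialAlgebra F E] (L : DiffOp K) (y : F) :
    L.apply (algebraMap F E y) = algebraMap F E (L.apply y) := by
  simp only [apply, Polynomial.sum, map_sum, map_mul, iterate_deriv_algebraMap,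
    ← IsScalarTower.algebraMap_apply]

end Tower

/-! ### Right division by first-order operators -/

/-- The noncommutative powers `R_i(q)`: `R_0 = 1` and `R_(i+1) = R_i′ + q R_i`.  If `f′ = q f`, then
the `i`-th derivative of `f` is `R_i(q) f`. -/
def riccatiPow {F : Type*} [Field F] [Differential F] (q : F) : ℕ → F
  | 0 => 1
  | i + 1 => (riccatiPow q i)′ + q * riccatiPow q i

/-- The Riccati expression `∑ a_i R_i(q)` of `L = ∑ a_i D^i`.  It is the remainder of the right
division of `L` by `D - q`. -/
noncomputable def riccati {K F : Type u} [Field K] [Field F] [Differential F] [Algebra K F]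
    (L : DiffOp K) (q : F) : F :=
  L.sum fun i a => algebraMap K F a * riccatiPow q i

section Riccati

variable {K : Type u} [Field K] {F : Type u} [Field F] [Differential F] [Algebra K F]

lemma riccati_monomial (i : ℕ) (a : K) (q : F) :
    riccati (monomial i a) q = algebraMap K F a * riccatiPow q i := by
  simp [riccati, sum_monomial_index]

lemma riccati_add (L M : DiffOp K) (q : F) : riccati (L + M) q = riccati L q + riccati M q :=
  sum_add_index _ _ _ (by simp) (by intros; rw [map_add, add_mul])

lemma apply_eq_riccati_mul (L : DiffOp K) {f q : F} (h : f′ = q * f) :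
    L.apply f = riccati L q * f := by
  have key : ∀ i, (fun x : F => x′)^[i] f = riccatiPow q i * f := by
    intro i
    induction i with
    | zero => simp [riccatiPow]
    | succ i ih =>
      rw [Function.iterate_succ_apply', ih, Derivation.leibniz, h, riccatiPow]
      simp only [smul_eq_mul]; ring
  simp only [apply, riccati, Polynomial.sum, key, Finset.sum_mul, mul_assoc]

variable [Differential K]

lemma riccatiPow_algebraMap [DifferentialAlgebra K F] (q : K) (i : ℕ) :
    riccatiPow (algebraMap K F q) i = algebraMap K F (riccatiPow q i) := by
  induction i with
  | zero => simp [riccatiPow]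
  | succ i ih => simp [riccatiPow, ih, deriv_algebraMap]

lemma riccati_algebraMap [DifferentialAlgebra K F] (L : DiffOp K) (q : K) :
    riccati L (algebraMap K F q) = algebraMap K F (riccati L q) := by
  simp [riccati, Polynomial.sum, riccatiPow_algebraMap]

/-- Right division by `D - q`. -/
lemma exists_comp_add_riccati (L : DiffOp K) (q : K) :
    ∃ M : DiffOp K, L = comp M (X - C q) + C (riccati L q) := by
  have key : ∀ i, ∃ M : DiffOp K, X ^ i = comp M (X - C q) + C (riccatiPow q i) := by
    intro i
    induction i with
    | zero => exact ⟨0, by simp [zero_comp, riccatiPow]⟩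
    | succ i ih =>
      obtain ⟨M, hM⟩ := ih
      refine ⟨derivComp M + C (riccatiPow q i), ?_⟩
      rw [← derivComp_iterate_one, Function.iterate_succ_apply', derivComp_iterate_one, hM,
        derivComp_add, add_comp, derivComp_comp, C_comp, riccatiPow]
      simp only [derivComp, Differential.mapCoeffs_C, map_add, map_mul]
      ring
  induction L using Polynomial.induction_on' with
  | add A B hA hB =>
    obtain ⟨M, hM⟩ := hA
    obtain ⟨N, hN⟩ := hB
    refine ⟨M + N, ?_⟩
    rw [riccati_add, add_comp, map_add]
    nth_rewrite 1 [hM, hN]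
    ring
  | monomial n b =>
    obtain ⟨M, hM⟩ := key n
    refine ⟨C b * M, ?_⟩
    rw [riccati_monomial, C_mul_comp, ← C_mul_X_pow_eq_monomial, hM, mul_add, ← C_mul]
    rfl

lemma exists_eq_comp_of_riccati_eq_zero {L : DiffOp K} {q : K} (h : riccati L q = 0) :
    ∃ M : DiffOp K, L = comp M (X - C q) := by
  simpa [h] using exists_comp_add_riccati L q

end Riccati

end DiffOp

/-! ### The dimension of the solution space -/

section Dimension

variable {E : Type u} [Field E] [Differential E]

lemma deriv_coe_constants (c : constants E) : (c : E)′ = 0 := c.2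

/-- The solutions of `L(y) = 0` in the field of coefficients, as a space over the constants. -/
noncomputable def solutions (L : DiffOp E) : Submodule (constants E) E where
  carrier := {y | L.apply y = 0}
  add_mem' {x y} hx hy := by
    simp only [Set.mem_ofPred_eq] at *
    rw [DiffOp.apply_add, hx, hy, add_zero]
  zero_mem' := DiffOp.apply_zero L
  smul_mem' c y hy := by
    simp only [Set.mem_ofPred_eq] at *
    rw [Subfield.smul_def, smul_eq_mul, DiffOp.apply_const_mul L (deriv_coe_constants c), hy,
      mul_zero]

lemma mem_solutions {L : DiffOp E} {y : E} : y ∈ solutions L ↔ L.apply y = 0 := Iff.rfl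

/-- The action of an operator as a linear map over the constants. -/
noncomputable def applyₗ (L : DiffOp E) : E →ₗ[constants E] E where
  toFun y := L.apply y
  map_add' := DiffOp.apply_add L
  map_smul' c y := by
    simp only [Subfield.smul_def, smul_eq_mul, RingHom.id_apply]
    exact DiffOp.apply_const_mul L (deriv_coe_constants c) y

/-- Two solutions of `y′ = q y` are proportional over the constants. -/
lemma deriv_div_eq_zero {q f g : E} (hf : f′ = q * f) (hg : g′ = q * g) : (g / f)′ = 0 := by
  rw [Derivation.leibniz_div, hf, hg]
  simp only [smul_eq_mul]
  ring_nf

lemma rank_ker_le_one {f q : E} (hf0 : f ≠ 0) (hf : f′ = q * f) :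
    Module.rank (constants E) (LinearMap.ker (applyₗ (X - C q : DiffOp E))) ≤ 1 := by
  have key : ∀ {g : E}, g ∈ LinearMap.ker (applyₗ (X - C q : DiffOp E)) ↔ g′ = q * g := by
    intro g
    rw [LinearMap.mem_ker]
    change DiffOp.apply _ _ = 0 ↔ _
    rw [DiffOp.X_sub_C_apply, sub_eq_zero]; rfl
  rw [rank_le_one_iff]
  refine ⟨⟨f, key.mpr hf⟩, fun ⟨g, hg⟩ => ⟨⟨g / f, deriv_div_eq_zero hf (key.mp hg)⟩, ?_⟩⟩
  ext
  simp [Subfield.smul_def, div_mul_cancel₀ _ hf0]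

/-- The solution space of a nonzero operator has at most the dimension of its order: a nonzero
solution `f` gives the right factor `D - f′/f`, which has a kernel of dimension one. -/
theorem rank_solutions_le (n : ℕ) (L : DiffOp E) (hL : L ≠ 0) (hn : L.natDegree ≤ n) :
    Module.rank (constants E) (solutions L) ≤ n := by
  induction n generalizing L with
  | zero =>
    obtain ⟨a, rfl⟩ := natDegree_eq_zero.mp (Nat.le_zero.mp hn)
    have : solutions (C a : DiffOp E) = ⊥ := by
      rw [eq_bot_iff]
      intro y hy
      rw [mem_solutions, DiffOp.C_apply] at hy
      have ha : a ≠ 0 := by simpa using hL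
      simpa [ha] using hy
    rw [this]; simp
  | succ n ih =>
    by_cases hbot : solutions L = ⊥
    · rw [hbot]; simp
    obtain ⟨f, hf, hf0⟩ := Submodule.exists_mem_ne_zero_of_ne_bot hbot
    set q : E := f′ / f with hq
    have hfq : f′ = q * f := by rw [hq, div_mul_cancel₀ _ hf0]
    have hr : DiffOp.riccati L q = 0 := by
      have := DiffOp.apply_eq_riccati_mul L hfq
      rw [mem_solutions.mp hf] at this
      simpa [hf0] using this.symm
    obtain ⟨M, hM⟩ := DiffOp.exists_eq_comp_of_riccati_eq_zero hr
    have hM0 : M ≠ 0 := by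
      rintro rfl
      exact hL (by rw [hM, DiffOp.zero_comp])
    have hdeg := DiffOp.natDegree_comp hM0 (X_sub_C_ne_zero q)
    rw [← hM, natDegree_X_sub_C] at hdeg
    set T := (applyₗ (X - C q : DiffOp E)).domRestrict (solutions L) with hT
    have h1 : Module.rank (constants E) (LinearMap.range T) ≤ n := by
      refine le_trans (Submodule.rank_mono ?_) (ih M hM0 (by omega))
      rintro _ ⟨⟨y, hy⟩, rfl⟩
      rw [mem_solutions, hM, DiffOp.comp_apply] at hy
      exact hy
    have h2 : Module.rank (constants E) (LinearMap.ker T) ≤ 1 := by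
      refine le_trans ?_ (rank_ker_le_one hf0 hfq)
      refine LinearMap.rank_le_of_injective
        (((solutions L).subtype.comp (LinearMap.ker T).subtype).codRestrict _ fun y => y.2) ?_
      intro a b h
      have := congrArg Subtype.val h
      exact Subtype.ext (Subtype.ext this)
    rw [← LinearMap.rank_range_add_rank_ker T]
    push_cast
    exact add_le_add h1 h2

lemma card_le_of_linearIndependent_solutions {n m : ℕ} {L : DiffOp E} (hL : L ≠ 0)
    (hn : L.natDegree ≤ n) {v : Fin m → E} (hv : LinearIndependent (constants E) v)
    (h : ∀ i, L.apply (v i) = 0) : m ≤ n := by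
  have hv' : LinearIndependent (constants E) (fun i => (⟨v i, h i⟩ : solutions L)) :=
    LinearIndependent.of_comp (solutions L).subtype hv
  have := hv'.cardinal_lift_le_rank.trans (Cardinal.lift_le.mpr (rank_solutions_le n L hL hn))
  simpa using this

end Dimension

/-! ### Residues at a special transcendental element -/

section Residue

variable {M E : Type u} [Field M] [Field E] [Algebra M E]

/-- `x = A(y)/B(y)` with `B(0) ≠ 0` and `r = A(0)/B(0)`: the value `r` of the rational function `x`
at the place `y = 0`. -/
def HasResidue (y : E) (x : E) (r : M) : Prop :=
  ∃ A B : M[X], B.coeff 0 ≠ 0 ∧ x * aeval y B = aeval y A ∧ r * B.coeff 0 = A.coeff 0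

namespace HasResidue

variable {y x x₁ x₂ : E} {r r₁ r₂ : M}

lemma ofBase (y : E) (r : M) : HasResidue y (algebraMap M E r) r :=
  ⟨C r, 1, by simp, by simp, by simp⟩

lemma one (y : E) : HasResidue y 1 (1 : M) := by
  simpa using ofBase (M := M) y 1

lemma zero (y : E) : HasResidue y 0 (0 : M) := by
  simpa using ofBase (M := M) y 0

lemma add (h₁ : HasResidue y x₁ r₁) (h₂ : HasResidue y x₂ r₂) :
    HasResidue y (x₁ + x₂) (r₁ + r₂) := by
  obtain ⟨A₁, B₁, hB₁, hx₁, hr₁⟩ := h₁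
  obtain ⟨A₂, B₂, hB₂, hx₂, hr₂⟩ := h₂
  refine ⟨A₁ * B₂ + A₂ * B₁, B₁ * B₂, ?_, ?_, ?_⟩
  · rw [mul_coeff_zero]; exact mul_ne_zero hB₁ hB₂
  · simp only [map_add, map_mul, ← hx₁, ← hx₂]; ring
  · simp only [coeff_add, mul_coeff_zero, ← hr₁, ← hr₂]; ring

lemma mul (h₁ : HasResidue y x₁ r₁) (h₂ : HasResidue y x₂ r₂) :
    HasResidue y (x₁ * x₂) (r₁ * r₂) := by
  obtain ⟨A₁, B₁, hB₁, hx₁, hr₁⟩ := h₁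
  obtain ⟨A₂, B₂, hB₂, hx₂, hr₂⟩ := h₂
  refine ⟨A₁ * A₂, B₁ * B₂, ?_, ?_, ?_⟩
  · rw [mul_coeff_zero]; exact mul_ne_zero hB₁ hB₂
  · simp only [map_mul, ← hx₁, ← hx₂]; ring
  · simp only [mul_coeff_zero, ← hr₁, ← hr₂]; ring

lemma pow (h : HasResidue y x r) (n : ℕ) : HasResidue y (x ^ n) (r ^ n) := by
  induction n with
  | zero => simpa using one y
  | succ n ih => simpa only [pow_succ] using ih.mul h

lemma sum {ι : Type*} (s : Finset ι) {f : ι → E} {g : ι → M}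
    (h : ∀ i ∈ s, HasResidue y (f i) (g i)) : HasResidue y (∑ i ∈ s, f i) (∑ i ∈ s, g i) := by
  classical
  induction s using Finset.induction_on with
  | empty => simpa using zero y
  | insert a s ha ih =>
    rw [Finset.sum_insert ha, Finset.sum_insert ha]
    exact (h a (by simp)).add (ih fun i hi => h i (by simp [hi]))

/-- The value of a constant rational function is that constant. -/
lemma eq_of_algebraMap (hy : Transcendental M y) {a : M}
    (h : HasResidue y (algebraMap M E a) r) : r = a := by
  obtain ⟨A, B, hB, hx, hr⟩ := h
  have h0 : C a * B = A := by
    apply (transcendental_iff_injective.mp hy)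
    simpa using hx
  rw [← h0, coeff_C_mul] at hr
  exact mul_right_cancel₀ hB hr

/-- Rational functions form a valuation ring at `y = 0`. -/
lemma exists_or_inv {A B : M[X]} (hy : Transcendental M y) (hB : B ≠ 0) :
    (∃ r : M, HasResidue y (aeval y A / aeval y B) r) ∨
      HasResidue y (aeval y A / aeval y B)⁻¹ (0 : M) := by
  classical
  have hinj := transcendental_iff_injective.mp hy
  obtain ⟨A', hA'⟩ := EuclideanDomain.gcd_dvd_left A B
  obtain ⟨B', hB'⟩ := EuclideanDomain.gcd_dvd_right A B
  have hG : EuclideanDomain.gcd A B ≠ 0 := fun h => hB (EuclideanDomain.gcd_eq_zero_iff.mp h).2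
  set G := EuclideanDomain.gcd A B with hGdef
  have hco : IsCoprime A' B' := by
    obtain ⟨u, v, huv⟩ : ∃ u v, G = A * u + B * v := ⟨_, _, EuclideanDomain.gcd_eq_gcd_ab A B⟩
    refine ⟨u, v, mul_left_cancel₀ hG ?_⟩
    calc G * (u * A' + v * B') = (G * A') * u + (G * B') * v := by ring
      _ = G * 1 := by rw [← hA', ← hB', ← huv, mul_one]
  have hB'0 : B' ≠ 0 := by
    rintro rfl
    exact hB (by rw [hB', mul_zero])
  have hne : ∀ {P : M[X]}, P ≠ 0 → aeval y P ≠ 0 := fun hP h => hP (hinj (by simpa using h))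
  have hdiv : aeval y A / aeval y B = aeval y A' / aeval y B' := by
    rw [hA', hB', map_mul, map_mul, mul_div_mul_left _ _ (hne hG)]
  rw [hdiv]
  by_cases h0 : B'.coeff 0 = 0
  · right
    have hA0 : A'.coeff 0 ≠ 0 := by
      intro hA0
      obtain ⟨u, v, huv⟩ := hco
      have := congrArg (fun P : M[X] => P.coeff 0) huv
      simp [mul_coeff_zero, hA0, h0] at this
    have hA'0 : A' ≠ 0 := by rintro rfl; simp at hA0
    refine ⟨B', A', hA0, ?_, by simp [h0]⟩
    rw [inv_div, div_mul_cancel₀ _ (hne hA'0)]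
  · left
    refine ⟨A'.coeff 0 / B'.coeff 0, A', B', h0, ?_, ?_⟩
    · rw [div_mul_cancel₀ _ (hne hB'0)]
    · rw [div_mul_cancel₀ _ h0]

variable [Differential M] [Differential E] [DifferentialAlgebra M E]

/-- As `y′` vanishes at `y = 0`, taking the value at `y = 0` commutes with differentiation. -/
lemma deriv (hy : IsSpecialTranscendental M y) (h : HasResidue y x r) :
    HasResidue y x′ r′ := by
  obtain ⟨hyt, P, Q, hPQ, hy'⟩ := hy
  have hinj := transcendental_iff_injective.mp hyt
  have hQ0 : Q.coeff 0 ≠ 0 := by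
    intro hQ0
    obtain ⟨u, v, huv⟩ := hPQ
    have := congrArg (fun P : M[X] => P.coeff 0) huv
    simp [mul_coeff_zero, hQ0] at this
  have hQ : aeval y Q ≠ 0 := by
    intro h
    have : Q = 0 := hinj (by simpa using h)
    simp [this] at hQ0
  obtain ⟨A, B, hB, hx, hr⟩ := h
  let δ : M[X] → M[X] := fun A => Differential.mapCoeffs A * Q + derivative A * (X * P)
  have hδ : ∀ A : M[X], aeval y (δ A) = (aeval y A)′ * aeval y Q := by
    intro A
    rw [Differential.deriv_aeval_eq, hy']
    simp only [δ, map_add, map_mul]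
    field_simp
  have hδ0 : ∀ A : M[X], (δ A).coeff 0 = (A.coeff 0)′ * Q.coeff 0 := by
    intro A
    simp [δ, mul_coeff_zero]
  refine ⟨δ A * B - A * δ B, Q * B ^ 2, ?_, ?_, ?_⟩
  · rw [pow_two, mul_coeff_zero, mul_coeff_zero]
    exact mul_ne_zero hQ0 (mul_ne_zero hB hB)
  · have h2 := congrArg (fun z : E => z′) hx
    simp only [Derivation.leibniz, smul_eq_mul] at h2
    simp only [map_sub, map_mul, map_pow, hδ]
    rw [← h2, ← hx]
    ring
  · have h2 := congrArg (fun z : M => z′) hr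
    simp only [Derivation.leibniz, smul_eq_mul] at h2
    rw [pow_two]
    simp only [coeff_sub, mul_coeff_zero, hδ0]
    rw [← h2, ← hr]
    ring

lemma riccatiPow {q : E} (hy : IsSpecialTranscendental M y) (h : HasResidue y q r) (i : ℕ) :
    HasResidue y (DiffOp.riccatiPow q i) (DiffOp.riccatiPow r i) := by
  induction i with
  | zero => exact one y
  | succ i ih => exact (ih.deriv hy).add (h.mul ih)

lemma riccati {q : E} (hy : IsSpecialTranscendental M y) (h : HasResidue y q r) (L : M[X]) :
    HasResidue y (DiffOp.riccati L q) (DiffOp.riccati L r) := by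
  unfold DiffOp.riccati Polynomial.sum
  exact sum _ fun i _ => (ofBase y _).mul (h.riccatiPow hy i)

/-- At a pole of `q`, the power `q^i` dominates `R_i(q)`. -/
lemma pow_mul_riccatiPow {s : E} (hy : IsSpecialTranscendental M y) (hs : s ≠ 0)
    (h : HasResidue y s (0 : M)) (i : ℕ) :
    HasResidue y (s ^ i * DiffOp.riccatiPow s⁻¹ i) (1 : M) := by
  induction i with
  | zero => simpa [DiffOp.riccatiPow] using one y
  | succ i ih =>
    -- with `T_i = s^i R_i(1/s)` one has `T_(i+1) = T_i + s T_i′ - i s′ T_i`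
    have key : s ^ (i + 1) * DiffOp.riccatiPow s⁻¹ (i + 1) =
        s ^ i * DiffOp.riccatiPow s⁻¹ i + s * (s ^ i * DiffOp.riccatiPow s⁻¹ i)′ +
          algebraMap M E (-(i : M)) * s′ * (s ^ i * DiffOp.riccatiPow s⁻¹ i) := by
      simp only [DiffOp.riccatiPow, Derivation.leibniz, Derivation.leibniz_pow, smul_eq_mul,
        nsmul_eq_mul, map_neg, map_natCast]
      cases i with
      | zero => simp [DiffOp.riccatiPow, hs]
      | succ i => field_simp; simp only [Nat.add_sub_cancel]; ring
    rw [key]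
    have := (ih.add (h.mul (ih.deriv hy))).add
      (((ofBase y (-(i : M))).mul (h.deriv hy)).mul ih)
    simpa using this

/-- A rational function that satisfies the Riccati equation of an operator over `M` has no pole at
`y = 0`. -/
lemma riccati_inv_ne_zero {s : E} (hy : IsSpecialTranscendental M y) (hs : s ≠ 0)
    (h : HasResidue y s (0 : M)) {L : M[X]} (hL : L ≠ 0) : DiffOp.riccati L s⁻¹ ≠ 0 := by
  intro h0
  have h1 : s ^ L.natDegree * DiffOp.riccati L s⁻¹ =
      ∑ i ∈ L.support, algebraMap M E (L.coeff i) * s ^ (L.natDegree - i) *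
        (s ^ i * DiffOp.riccatiPow s⁻¹ i) := by
    rw [DiffOp.riccati, Polynomial.sum, Finset.mul_sum]
    refine Finset.sum_congr rfl fun i hi => ?_
    have := pow_sub_mul_pow s (le_natDegree_of_mem_supp i hi)
    rw [← this]; ring
  have h2 : HasResidue y (s ^ L.natDegree * DiffOp.riccati L s⁻¹)
      (∑ i ∈ L.support, L.coeff i * 0 ^ (L.natDegree - i) * 1) := by
    rw [h1]
    exact sum _ fun i _ => ((ofBase y _).mul (h.pow _)).mul (h.pow_mul_riccatiPow hy hs i)
  rw [h0, mul_zero, ← map_zero (algebraMap M E)] at h2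
  have h3 := h2.eq_of_algebraMap hy.1
  rw [Finset.sum_eq_single L.natDegree] at h3
  · simp [hL] at h3
  · intro i hi hne
    have h4 := le_natDegree_of_mem_supp i hi
    have : L.natDegree - i ≠ 0 := by omega
    simp [this]
  · intro h5
    simp [notMem_support_iff.mp h5]

end HasResidue

end Residue

/-! ### Differential subfields -/

section Subfields

variable {K E : Type u} [Field K] [Field E] [Differential E] [Algebra K E]

/-- The derivation of an intermediate field that is closed under differentiation. -/
@[reducible]
def differentialOfClosed (M : IntermediateField K E) (hM : ∀ x ∈ M, x′ ∈ M) : Differential M where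
  deriv := Derivation.mk'
    { toFun := fun x => ⟨(x : E)′, hM x x.2⟩
      map_add' := fun x y => Subtype.ext (by simp)
      map_smul' := fun c x => Subtype.ext (by simp) }
    fun x y => Subtype.ext (by simp)

lemma differentialAlgebra_of_closed (M : IntermediateField K E) (hM : ∀ x ∈ M, x′ ∈ M) :
    letI := differentialOfClosed M hM
    DifferentialAlgebra M E :=
  letI := differentialOfClosed M hM
  ⟨fun _ => rfl⟩

lemma differentialAlgebra_base_of_closed [Differential K] [DifferentialAlgebra K E]
    (M : IntermediateField K E) (hM : ∀ x ∈ M, x′ ∈ M) :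
    letI := differentialOfClosed M hM
    DifferentialAlgebra K M :=
  letI := differentialOfClosed M hM
  ⟨fun a => Subtype.ext (deriv_algebraMap (B := E) a)⟩

lemma le_diffAdjoin (M : IntermediateField K E) (y : E) : M ≤ diffAdjoin M y :=
  le_sInf fun _ hN => hN.1

lemma mem_diffAdjoin_self (M : IntermediateField K E) (y : E) : y ∈ diffAdjoin M y := by
  rw [diffAdjoin, IntermediateField.mem_sInf]
  exact fun N hN => hN.2.1

lemma deriv_mem_diffAdjoin (M : IntermediateField K E) (y : E) :
    ∀ x ∈ diffAdjoin M y, x′ ∈ diffAdjoin M y := by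
  intro x hx
  rw [diffAdjoin, IntermediateField.mem_sInf] at *
  exact fun N hN => hN.2.2 x (hx N hN)

lemma diffAdjoin_le {M N : IntermediateField K E} {y : E} (hMN : M ≤ N) (hy : y ∈ N)
    (hN : ∀ x ∈ N, x′ ∈ N) : diffAdjoin M y ≤ N :=
  sInf_le ⟨hMN, hy, hN⟩

lemma deriv_mem_bot [Differential K] [DifferentialAlgebra K E] :
    ∀ x ∈ (⊥ : IntermediateField K E), x′ ∈ (⊥ : IntermediateField K E) := by
  intro x hx
  obtain ⟨a, rfl⟩ := IntermediateField.mem_bot.mp hx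
  exact IntermediateField.mem_bot.mpr ⟨a′, (deriv_algebraMap a).symm⟩

lemma deriv_div_mem {F : Type*} [Field F] [Algebra F E] (S : IntermediateField F E) {a b : E}
    (ha : a ∈ S) (hb : b ∈ S) (ha' : a′ ∈ S) (hb' : b′ ∈ S) : (a / b)′ ∈ S := by
  have : (a / b)′ = (b * a′ - a * b′) / b ^ 2 := by
    rw [Derivation.leibniz_div]
    simp only [smul_eq_mul]
    ring
  rw [this]
  exact S.div_mem (S.sub_mem (S.mul_mem hb ha') (S.mul_mem ha hb')) (pow_mem hb 2)

/-- If `y′` is a rational function of `y` over `M`, then so are all elements of `M⟨y⟩`. -/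
lemma exists_eq_div_of_mem_diffAdjoin {M : IntermediateField K E} (hM : ∀ x ∈ M, x′ ∈ M) {y : E}
    (hy : y′ ∈ IntermediateField.adjoin M {y}) {x : E} (hx : x ∈ diffAdjoin M y) :
    ∃ A B : M[X], x = aeval y A / aeval y B := by
  let _ : Differential M := differentialOfClosed M hM
  have := differentialAlgebra_of_closed M hM
  rw [← IntermediateField.mem_adjoin_simple_iff]
  have hpoly : ∀ A : M[X], aeval y A ∈ IntermediateField.adjoin M {y} := fun A =>
    (IntermediateField.mem_adjoin_simple_iff _ _).mpr ⟨A, 1, by simp⟩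
  have hpoly' : ∀ A : M[X], (aeval y A)′ ∈ IntermediateField.adjoin M {y} := fun A => by
    rw [Differential.deriv_aeval_eq]
    exact add_mem (hpoly _) (mul_mem (hpoly _) hy)
  have hle : diffAdjoin M y ≤ (IntermediateField.adjoin M {y}).restrictScalars K := by
    refine diffAdjoin_le ?_ ((IntermediateField.mem_restrictScalars K).mpr
      (IntermediateField.mem_adjoin_simple_self M y)) ?_
    · intro a ha
      rw [IntermediateField.mem_restrictScalars]
      exact (IntermediateField.adjoin M {y}).algebraMap_mem (⟨a, ha⟩ : M)
    · intro a ha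
      rw [IntermediateField.mem_restrictScalars] at ha
      obtain ⟨A, B, rfl⟩ := (IntermediateField.mem_adjoin_simple_iff _ _).mp ha
      rw [IntermediateField.mem_restrictScalars]
      exact deriv_div_mem _ (hpoly A) (hpoly B) (hpoly' A) (hpoly' B)
  exact hle hx

lemma IsSpecialTranscendental.deriv_mem_adjoin {M : IntermediateField K E} {y : E}
    (h : IsSpecialTranscendental M y) : y′ ∈ IntermediateField.adjoin M {y} := by
  obtain ⟨-, P, Q, -, h⟩ := h
  exact (IntermediateField.mem_adjoin_simple_iff _ _).mpr ⟨X * P, Q, h⟩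

/-- Any element of `M⟨y⟩`, or its inverse, has a value at `y = 0`. -/
lemma IsSpecialTranscendental.exists_hasResidue {M : IntermediateField K E}
    (hM : ∀ x ∈ M, x′ ∈ M) {y : E} (h : IsSpecialTranscendental M y) {x : E}
    (hx : x ∈ diffAdjoin M y) :
    (∃ r : M, HasResidue y x r) ∨ (x ≠ 0 ∧ HasResidue y x⁻¹ (0 : M)) := by
  obtain ⟨A, B, rfl⟩ := exists_eq_div_of_mem_diffAdjoin hM h.deriv_mem_adjoin hx
  by_cases h0 : aeval y A / aeval y B = 0
  · exact Or.inl ⟨0, by rw [h0]; exact HasResidue.zero y⟩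
  have hB : B ≠ 0 := by
    rintro rfl
    simp at h0
  exact (HasResidue.exists_or_inv h.1 hB).imp id fun h1 => ⟨h0, h1⟩

/-- Induction along the chain of an admissible extension. -/
lemma IsAdmissible.induction [Differential K] [DifferentialAlgebra K E] (h : IsAdmissible K E)
    {P : IntermediateField K E → Prop} (bot : P ⊥)
    (adjoin : ∀ (M : IntermediateField K E) (y : E), (∀ x ∈ M, x′ ∈ M) →
      IsSpecialTranscendental M y → P M → P (diffAdjoin M y)) : P ⊤ := by
  obtain ⟨m, M, h0, hlast, hstep⟩ := h
  have key : ∀ i : Fin (m + 1), (∀ x ∈ M i, x′ ∈ M i) ∧ P (M i) := by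
    intro i
    induction i using Fin.induction with
    | zero => rw [h0]; exact ⟨deriv_mem_bot, bot⟩
    | succ i ih =>
      obtain ⟨y, hy, hM⟩ := hstep i
      rw [hM]
      exact ⟨deriv_mem_diffAdjoin _ _, adjoin _ _ ih.1 hy ih.2⟩
  rw [← hlast]
  exact (key _).2

end Subfields

/-! ### Admissible extensions: first-order factors and radicals -/

section Admissible

variable {K E : Type u} [Field K] [Differential K] [Field E] [Differential E] [Algebra K E]
  [DifferentialAlgebra K E]

omit [Differential K] [DifferentialAlgebra K E] in
lemma DiffOp.riccati_map {F : Type u} [Field F] [Algebra K F] [Algebra F E] [IsScalarTower K F E]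
    (L : DiffOp K) (q : E) : DiffOp.riccati (L.map (algebraMap K F)) q = DiffOp.riccati L q := by
  induction L using Polynomial.induction_on' with
  | add p q hp hq => simp only [Polynomial.map_add, riccati_add, hp, hq]
  | monomial n b =>
    rw [map_monomial, riccati_monomial, riccati_monomial, ← IsScalarTower.algebraMap_apply]

/-- A solution of the Riccati equation of `L` in an admissible extension specializes to one in `K`,
by taking values at `y = 0` at each step of the chain. -/
theorem IsAdmissible.exists_riccati_eq_zero (h : IsAdmissible K E) {L : DiffOp K} (hL : L ≠ 0)
    {q : E} (hq : DiffOp.riccati L q = 0) : ∃ q₀ : K, DiffOp.riccati L q₀ = 0 := by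
  refine h.induction (P := fun M => ∀ q ∈ M, DiffOp.riccati L q = 0 →
    ∃ q₀ : K, DiffOp.riccati L q₀ = 0) ?_ ?_ q trivial hq
  · intro q hq h0
    obtain ⟨a, rfl⟩ := IntermediateField.mem_bot.mp hq
    rw [DiffOp.riccati_algebraMap] at h0
    exact ⟨a, (map_eq_zero _).mp h0⟩
  · intro M y hM hy ih q hq h0
    let _ : Differential M := differentialOfClosed M hM
    have := differentialAlgebra_of_closed M hM
    rw [← DiffOp.riccati_map (F := M)] at h0
    rcases hy.exists_hasResidue hM hq with ⟨r, hr⟩ | ⟨hq0, hr⟩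
    · refine ih r r.2 ?_
      have h1 := hr.riccati hy (L.map (algebraMap K M))
      rw [h0, ← map_zero (algebraMap M E)] at h1
      have h2 := h1.eq_of_algebraMap hy.1
      change DiffOp.riccati L (algebraMap M E r) = 0
      rw [← DiffOp.riccati_map (F := M), DiffOp.riccati_algebraMap, h2, map_zero]
    · have h1 := HasResidue.riccati_inv_ne_zero hy (inv_ne_zero hq0) hr
        (L := L.map (algebraMap K M)) (by simpa using hL)
      rw [inv_inv] at h1
      exact absurd h0 h1

/-- The base field is radically closed in an admissible extension without new constants: a radical
differs from its value at `y = 0` by a root of unity, which is a constant. -/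
theorem IsAdmissible.mem_range_of_pow_eq [CharZero K] [Differential.ContainConstants K E]
    (h : IsAdmissible K E) {k : ℕ} (hk : k ≠ 0) {a : K} (ha : a ≠ 0) {z : E}
    (hz : z ^ k = algebraMap K E a) : z ∈ (algebraMap K E).range := by
  have : CharZero E := charZero_of_injective_algebraMap (algebraMap K E).injective
  refine h.induction (P := fun M => ∀ z ∈ M, z ^ k = algebraMap K E a →
    z ∈ (algebraMap K E).range) ?_ ?_ z trivial hz
  · exact fun z hz _ => IntermediateField.mem_bot.mp hz
  · intro M y hM hy ih z hz hzk
    let _ : Differential M := differentialOfClosed M hM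
    have := differentialAlgebra_of_closed M hM
    rw [IsScalarTower.algebraMap_apply K M E] at hzk
    have ha' : algebraMap K M a ≠ 0 := by simpa using ha
    rcases hy.exists_hasResidue hM hz with ⟨r, hr⟩ | ⟨hz0, hr⟩
    · refine ih z ?_ (by rw [hzk, ← IsScalarTower.algebraMap_apply])
      have h1 := hr.pow k
      rw [hzk] at h1
      have h2 : r ^ k = algebraMap K M a := h1.eq_of_algebraMap hy.1
      have hr0 : (r : E) ≠ 0 := by
        intro h0
        have : r = 0 := Subtype.ext h0
        rw [this, zero_pow hk] at h2
        exact ha' h2.symm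
      have hroot : (z / r) ^ k = 1 := by
        have h3 : (r : E) ^ k = algebraMap M E (algebraMap K M a) := by rw [← h2]; rfl
        rw [div_pow, hzk, ← h3, div_self (pow_ne_zero _ hr0)]
      have hz0 : z / r ≠ 0 := by
        intro h0
        rw [h0, zero_pow hk] at hroot
        exact zero_ne_one hroot
      have hconst : (z / r)′ = 0 := by
        have h3 := congrArg (fun t : E => t′) hroot
        simp only [Derivation.leibniz_pow, Derivation.map_one_eq_zero, smul_eq_mul,
          nsmul_eq_mul] at h3
        simpa [hk, hz0] using h3
      obtain ⟨c, hc⟩ := mem_range_of_deriv_eq_zero K hconst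
      have : z = algebraMap K E c * r := by rw [hc, div_mul_cancel₀ _ hr0]
      rw [this]
      exact mul_mem (M.algebraMap_mem c) r.2
    · have h1 := hr.pow k
      rw [inv_pow, hzk, ← map_inv₀] at h1
      have h2 := h1.eq_of_algebraMap hy.1
      rw [zero_pow hk] at h2
      exact absurd h2.symm (inv_ne_zero ha')

/-! ### Factorization -/

lemma linearIndependent_constants_iff [Differential.ContainConstants K E] {n : ℕ} {v : Fin n → E} :
    LinearIndependent (constants K) v ↔ LinearIndependent (constants E) v := by
  have hK : ∀ (c : constants K) (x : E), c • x = algebraMap K E c * x := fun c x => by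
    rw [Subfield.smul_def, Algebra.smul_def]
  have hE : ∀ (c : constants E) (x : E), c • x = (c : E) * x := fun c x => rfl
  simp only [Fintype.linearIndependent_iff, hK, hE]
  constructor
  · intro h g hg
    have h1 : ∀ i, ∃ c : K, algebraMap K E c = g i := fun i =>
      mem_range_of_deriv_eq_zero K (g i).2
    choose c hc using h1
    have hc' : ∀ i, (c i)′ = 0 := fun i => by
      apply (algebraMap K E).injective
      rw [← deriv_algebraMap, hc, map_zero]
      exact (g i).2
    intro i
    have h2 := h (fun i => ⟨c i, hc' i⟩) (by simpa only [hc] using hg) i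
    apply Subtype.ext
    rw [← hc, show c i = 0 from congrArg Subtype.val h2]
    simp
  · intro h g hg i
    have h1 : ∀ i, (algebraMap K E (g i))′ = 0 := fun i => by
      rw [deriv_algebraMap, show ((g i : K))′ = 0 from (g i).2, map_zero]
    have h2 := h (fun i => ⟨algebraMap K E (g i), h1 i⟩) hg i
    apply Subtype.ext
    apply (algebraMap K E).injective
    simpa using congrArg Subtype.val h2

omit [Field E] [Differential E] [Algebra K E] [DifferentialAlgebra K E] in
lemma DiffOp.prodLinear_cons {n : ℕ} (q : K) (p : Fin n → K) :
    prodLinear (Fin.cons q p) = comp (prodLinear p) (X - C q) := by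
  have key : ∀ (l : List K) (M : DiffOp K),
      l.foldl (fun M q => comp (X - C q) M) M =
        comp (l.foldl (fun M q => comp (X - C q) M) 1) M := by
    intro l
    induction l with
    | nil => intro M; simp [one_comp]
    | cons a l ih =>
      intro M
      rw [List.foldl_cons, List.foldl_cons, ih, comp_one, ih (X - C a), comp_assoc]
  rw [prodLinear, List.ofFn_succ, List.foldl_cons, key, comp_one]
  simp [prodLinear]

omit [Field E] [Differential E] [Algebra K E] [DifferentialAlgebra K E] in
lemma DiffOp.prodLinear_succ {n : ℕ} (p : Fin (n + 1) → K) :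
    prodLinear p = comp (X - C (p (Fin.last n))) (prodLinear fun i => p i.castSucc) := by
  rw [prodLinear, List.ofFn_succ', List.concat_eq_append, List.foldl_append]
  rfl

/-- If `D - q` is a right factor of an operator of order `n + 1` with all its solutions in `E`, then
it has a nonzero solution, and it maps the solutions onto those of the other factor. -/
lemma exists_solutions_of_comp {n : ℕ} {M : DiffOp E} (hM : M ≠ 0) (hn : M.natDegree = n) {q : E}
    {v : Fin (n + 1) → E} (hv : LinearIndependent (constants E) v)
    (hs : ∀ i, (DiffOp.comp M (X - C q)).apply (v i) = 0) :
    (∃ z : E, z ≠ 0 ∧ z′ = q * z) ∧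
      ∃ w : Fin n → E, LinearIndependent (constants E) w ∧ ∀ i, M.apply (w i) = 0 := by
  set V := Submodule.span (constants E) (Set.range v) with hV
  have hVs : V ≤ solutions (DiffOp.comp M (X - C q)) := by
    rw [hV, Submodule.span_le]
    rintro _ ⟨i, rfl⟩
    exact hs i
  have hVn : Module.finrank (constants E) V = n + 1 := by
    rw [finrank_span_eq_card hv, Fintype.card_fin]
  have : FiniteDimensional (constants E) V :=
    FiniteDimensional.span_of_finite _ (Set.finite_range v)
  set T := (applyₗ (X - C q : DiffOp E)).domRestrict V with hT
  have hsum := LinearMap.finrank_range_add_finrank_ker T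
  rw [hVn] at hsum
  have hrange : ∀ w ∈ LinearMap.range T, M.apply w = 0 := by
    rintro _ ⟨⟨y, hy⟩, rfl⟩
    have := hVs hy
    rwa [mem_solutions, DiffOp.comp_apply] at this
  have h1 : Module.finrank (constants E) (LinearMap.range T) ≤ n :=
    Module.finrank_le_of_rank_le
      ((Submodule.rank_mono hrange).trans (rank_solutions_le n M hM hn.le))
  have hker : LinearMap.ker T ≠ ⊥ := by
    intro h
    rw [h, finrank_bot] at hsum
    omega
  obtain ⟨⟨z, hzV⟩, hz, hz0⟩ := Submodule.exists_mem_ne_zero_of_ne_bot hker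
  have hz0' : z ≠ 0 := fun h => hz0 (Subtype.ext h)
  have hzq : z′ = q * z := by
    have h2 : DiffOp.apply (X - C q : DiffOp E) z = 0 := hz
    rwa [DiffOp.X_sub_C_apply, sub_eq_zero] at h2
  have h2 : Module.finrank (constants E) (LinearMap.ker T) ≤ 1 := by
    refine Module.finrank_le_of_rank_le ((LinearMap.rank_le_of_injective
      ((V.subtype.comp (LinearMap.ker T).subtype).codRestrict
        (LinearMap.ker (applyₗ (X - C q : DiffOp E))) fun y => y.2) ?_).trans
      ((rank_ker_le_one hz0' hzq).trans (by simp)))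
    intro a b h
    have h' := congrArg Subtype.val h
    exact Subtype.ext (Subtype.ext h')
  have h3 : Module.finrank (constants E) (LinearMap.range T) = n := by omega
  refine ⟨⟨z, hz0', hzq⟩, ?_⟩
  let b := Module.finBasisOfFinrankEq (constants E) (LinearMap.range T) h3
  exact ⟨fun i => b i, b.linearIndependent.map' (LinearMap.range T).subtype
    (Submodule.ker_subtype _), fun i => hrange _ (b i).2⟩

/-- An operator with all its solutions in an admissible extension is a product of first-order
operators `D - p_i` over the base field, each of which has a nonzero solution in the extension. -/
theorem IsAdmissible.exists_factorization (h : IsAdmissible K E) (n : ℕ) (L : DiffOp K)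
    (hL : L ≠ 0) (hn : L.natDegree = n) (v : Fin n → E)
    (hv : LinearIndependent (constants E) v) (hs : ∀ i, L.apply (v i) = 0) :
    ∃ (p : Fin n → K) (z : Fin n → E), (∀ i, z i ≠ 0) ∧
      (∀ i, (z i)′ = algebraMap K E (p i) * z i) ∧
      L = DiffOp.comp (C L.leadingCoeff) (DiffOp.prodLinear p) := by
  induction n generalizing L with
  | zero =>
    refine ⟨Fin.elim0, Fin.elim0, fun i => i.elim0, fun i => i.elim0, ?_⟩
    obtain ⟨a, rfl⟩ := natDegree_eq_zero.mp hn
    simp [DiffOp.prodLinear, DiffOp.comp_one]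
  | succ n ih =>
    have hf0 : v 0 ≠ 0 := hv.ne_zero 0
    have hr : DiffOp.riccati L ((v 0)′ / v 0) = 0 := by
      have := DiffOp.apply_eq_riccati_mul L (f := v 0) (q := (v 0)′ / v 0)
        (by rw [div_mul_cancel₀ _ hf0])
      rw [hs 0] at this
      simpa [hf0] using this.symm
    obtain ⟨q, hq⟩ := h.exists_riccati_eq_zero hL hr
    obtain ⟨M, hM⟩ := DiffOp.exists_eq_comp_of_riccati_eq_zero hq
    have hM0 : M ≠ 0 := by
      rintro rfl
      exact hL (by rw [hM, DiffOp.zero_comp])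
    have hdeg := DiffOp.natDegree_comp hM0 (X_sub_C_ne_zero q)
    have hlead := DiffOp.leadingCoeff_comp hM0 (X_sub_C_ne_zero q)
    rw [← hM, natDegree_X_sub_C] at hdeg
    rw [← hM, leadingCoeff_X_sub_C, mul_one] at hlead
    have hME : ∀ y : E, (DiffOp.comp (M.map (algebraMap K E)) (X - C (algebraMap K E q))).apply y =
        L.apply y := by
      intro y
      rw [DiffOp.comp_apply, hM, DiffOp.comp_apply, DiffOp.apply_map, DiffOp.X_sub_C_apply,
        DiffOp.X_sub_C_apply]
      rfl
    obtain ⟨⟨z₀, hz0, hzq⟩, w, hw, hws⟩ := exists_solutions_of_comp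
      (M := M.map (algebraMap K E)) (by simpa using hM0) (by rw [natDegree_map]; omega) hv
      (fun i => by rw [hME, hs])
    obtain ⟨p, z, hz, hzp, hMp⟩ := ih M hM0 (by omega) w hw fun i => by
      rw [← DiffOp.apply_map (F := E), hws]
    refine ⟨Fin.cons q p, Fin.cons z₀ z, ?_, ?_, ?_⟩
    · intro i
      induction i using Fin.cases with
      | zero => exact hz0
      | succ i => exact hz i
    · intro i
      induction i using Fin.cases with
      | zero => exact hzq
      | succ i => exact hzp i
    · rw [DiffOp.prodLinear_cons, ← DiffOp.comp_assoc, hlead, ← hMp, ← hM]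

omit [Differential K] [Differential E] [DifferentialAlgebra K E] in
lemma torsionFreeModBase_of_radicallyClosed {n : ℕ}
    (h : ∀ (z : Eˣ) (k : ℕ), k ≠ 0 → ∀ a : Kˣ, (z : E) ^ k = algebraMap K E a →
      (z : E) ∈ (algebraMap K E).range) (z : Fin n → Eˣ) :
    TorsionFreeModBase (K := K) z := by
  unfold TorsionFreeModBase
  refine (isMulTorsionFree_iff_not_isOfFinOrder (G := Subgroup.closure (Set.range z) ⧸
    (Units.map (algebraMap K E : K →* E)).range.subgroupOf
      (Subgroup.closure (Set.range z)))).mpr ?_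
  intro x hx hfin
  apply hx
  obtain ⟨g, rfl⟩ := QuotientGroup.mk_surjective x
  obtain ⟨k, hk, hgk⟩ := isOfFinOrder_iff_pow_eq_one.mp hfin
  rw [← QuotientGroup.mk_pow, QuotientGroup.eq_one_iff, Subgroup.mem_subgroupOf] at hgk
  rw [QuotientGroup.eq_one_iff, Subgroup.mem_subgroupOf]
  obtain ⟨a, ha⟩ := hgk
  obtain ⟨b, hb⟩ := h g k hk.ne' a (by
    have := congrArg Units.val ha
    simpa using this.symm)
  have hb0 : b ≠ 0 := by
    rintro rfl
    exact (g : Eˣ).ne_zero (by rw [← hb, map_zero])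
  exact ⟨Units.mk0 b hb0, Units.ext (by simpa using hb)⟩

end Admissible

/-! ### Adjoining primitives -/

/-- A derivation of a domain extends to its field of fractions: `a ↦ a + δ(a) ε` extends to a
homomorphism from the field of fractions to its dual numbers. -/
lemma exists_derivation_extension {A Q : Type*} [CommRing A] [IsDomain A] [Field Q] [Algebra A Q]
    [IsFractionRing A Q] (δ : A → A) (hadd : ∀ a b, δ (a + b) = δ a + δ b)
    (hmul : ∀ a b, δ (a * b) = a * δ b + b * δ a) :
    ∃ D : Derivation ℤ Q Q, ∀ a, D (algebraMap A Q a) = algebraMap A Q (δ a) := by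
  have h0 : δ 0 = 0 := by simpa using hadd 0 0
  have h1 : δ 1 = 0 := by simpa using hmul 1 1
  let φ : A →+* TrivSqZeroExt Q Q :=
    { toFun := fun a => TrivSqZeroExt.inl (algebraMap A Q a) +
        TrivSqZeroExt.inr (algebraMap A Q (δ a))
      map_one' := by ext <;> simp [h1]
      map_zero' := by ext <;> simp [h0]
      map_add' := fun a b => by
        ext <;> simp only [TrivSqZeroExt.fst_add, TrivSqZeroExt.fst_inl, TrivSqZeroExt.fst_inr,
          TrivSqZeroExt.snd_add, TrivSqZeroExt.snd_inl, TrivSqZeroExt.snd_inr, hadd, map_add] <;>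
          ring
      map_mul' := fun a b => by
        ext <;> simp only [TrivSqZeroExt.fst_add, TrivSqZeroExt.fst_inl, TrivSqZeroExt.fst_inr,
          TrivSqZeroExt.snd_add, TrivSqZeroExt.snd_inl, TrivSqZeroExt.snd_inr,
          TrivSqZeroExt.fst_mul, TrivSqZeroExt.snd_mul, smul_eq_mul,
          op_smul_eq_mul, hmul, map_mul, map_add, add_zero, zero_add]
        ring }
  have hφ1 : ∀ a, (φ a).fst = algebraMap A Q a := fun a => by
    change algebraMap A Q a + 0 = _
    rw [add_zero]
  have hφ2 : ∀ a, (φ a).snd = algebraMap A Q (δ a) := fun a => by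
    change 0 + algebraMap A Q (δ a) = _
    rw [zero_add]
  have hφ : ∀ a : nonZeroDivisors A, IsUnit (φ a) := by
    intro a
    rw [TrivSqZeroExt.isUnit_iff_isUnit_fst, hφ1]
    simp
  let ψ : Q →+* TrivSqZeroExt Q Q := IsLocalization.lift hφ
  have hψ : ∀ a, ψ (algebraMap A Q a) = φ a := fun a => IsLocalization.lift_eq hφ a
  have hfst : ∀ x, (ψ x).fst = x := by
    have : (TrivSqZeroExt.fstHom Q Q Q).toRingHom.comp ψ = RingHom.id Q := by
      apply IsLocalization.ringHom_ext (nonZeroDivisors A)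
      ext a
      simp [hψ, hφ1]
    exact fun x => congrArg (fun f : Q →+* Q => f x) this
  refine ⟨Derivation.mk'
    { toFun := fun x => (ψ x).snd
      map_add' := fun x y => by simp
      map_smul' := fun c x => by simp } fun x y => ?_, fun a => ?_⟩
  · change (ψ (x * y)).snd = x • (ψ y).snd + y • (ψ x).snd
    rw [map_mul, TrivSqZeroExt.snd_mul, hfst, hfst, op_smul_eq_mul, smul_eq_mul, smul_eq_mul,
      mul_comm y]
  · change (ψ _).snd = _
    rw [hψ, hφ2]

section Primitive

variable {F : Type u} [Field F] [Differential F]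

lemma deriv_mul (a b : F) : (a * b)′ = a * b′ + b * a′ := by
  simp [Derivation.leibniz]

lemma coeff_implicitDeriv_C (g : F) (P : F[X]) (k : ℕ) :
    (Differential.implicitDeriv (C g) P).coeff k =
      (P.coeff k)′ + g * (P.coeff (k + 1) * (k + 1)) := by
  simp [Differential.implicitDeriv, coeff_derivative]

lemma degree_implicitDeriv_lt (g : F) {P : F[X]} (hP : P.Monic) :
    (Differential.implicitDeriv (C g) P).degree < P.degree := by
  rw [degree_eq_natDegree hP.ne_zero, degree_lt_iff_coeff_zero]
  intro m hm
  rw [coeff_implicitDeriv_C, coeff_eq_zero_of_natDegree_lt (show P.natDegree < m + 1 by omega)]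
  rcases hm.eq_or_lt with rfl | hm
  · simp [hP.coeff_natDegree]
  · simp [coeff_eq_zero_of_natDegree_lt hm]

/-- If a nonconstant polynomial in a primitive `X` of `g` has derivative zero, then its two leading
coefficients provide a primitive of `g` in the field of coefficients. -/
lemma exists_primitive_of_implicitDeriv_eq_zero [CharZero F] {g : F} {P : F[X]}
    (h0 : P.natDegree ≠ 0) (h : Differential.implicitDeriv (C g) P = 0) : ∃ x : F, x′ = g := by
  obtain ⟨k, hk⟩ := Nat.exists_eq_succ_of_ne_zero h0
  have hlead : P.coeff (k + 1) ≠ 0 := by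
    rw [← Nat.succ_eq_add_one, ← hk, coeff_natDegree, leadingCoeff_ne_zero]
    rintro rfl
    simp at h0
  have h1 := coeff_implicitDeriv_C g P (k + 1)
  have h2 := coeff_implicitDeriv_C g P k
  rw [h, coeff_zero] at h1 h2
  rw [coeff_eq_zero_of_natDegree_lt (show P.natDegree < k + 1 + 1 by omega), zero_mul, mul_zero,
    add_zero] at h1
  have hk0 : ((k : F) + 1) ≠ 0 := by exact_mod_cast Nat.succ_ne_zero k
  have hc : (P.coeff (k + 1) * ((k : F) + 1))′ = 0 := by
    simp [Derivation.leibniz, ← h1]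
  refine ⟨-(P.coeff k / (P.coeff (k + 1) * (k + 1))), ?_⟩
  rw [map_neg, Derivation.leibniz_div, hc]
  simp only [smul_eq_mul]
  rw [eq_neg_of_add_eq_zero_left h2.symm]
  field_simp
  ring

/-- If `g` has no primitive in `F`, then a transcendental primitive can be adjoined to `F` without
new constants. -/
lemma exists_extension_primitive_of_not_exists [CharZero F] {g : F} (hg : ¬ ∃ x : F, x′ = g) :
    ∃ (F' : Type u) (_ : Field F') (_ : Differential F') (_ : Algebra F F')
      (_ : DifferentialAlgebra F F') (_ : Differential.ContainConstants F F') (x : F'),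
      x′ = algebraMap F F' g := by
  set δ : F[X] → F[X] := fun P => Differential.implicitDeriv (C g) P with hδ
  have hδmul : ∀ a b, δ (a * b) = a * δ b + b * δ a := fun a b => by
    simp [hδ, Derivation.leibniz]
  obtain ⟨D, hD⟩ := exists_derivation_extension (Q := FractionRing F[X]) δ
    (fun a b => by simp [hδ]) hδmul
  have hδC : ∀ a, δ (C a) = C a′ := fun a => Differential.implicitDeriv_C _ a
  have hδX : δ X = C g := Differential.implicitDeriv_X _
  have hmap : ∀ a : F, algebraMap F (FractionRing F[X]) a = algebraMap F[X] _ (C a) := fun a => by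
    rw [IsScalarTower.algebraMap_apply F F[X] (FractionRing F[X])]; rfl
  have hinj : Function.Injective (algebraMap F[X] (FractionRing F[X])) :=
    IsFractionRing.injective _ _
  have hconst : ∀ P : F[X], δ P = 0 → ∃ a, P = C a := fun P hP =>
    (natDegree_eq_zero.mp (by_contra fun h =>
      hg (exists_primitive_of_implicitDeriv_eq_zero h hP))).imp fun _ h => h.symm
  let _ : Differential (FractionRing F[X]) := ⟨D⟩
  refine ⟨FractionRing F[X], inferInstance, ⟨D⟩, inferInstance, ⟨fun a => ?_⟩, ⟨fun {c} hc => ?_⟩,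
    algebraMap F[X] _ X, ?_⟩
  · change D _ = _
    rw [hmap, hD, hδC, hmap]
  · replace hc : D c = 0 := hc
    obtain ⟨A, B, hAB, hcAB⟩ := IsFractionRing.exists_reduced_fraction (A := F[X]) c
    have hB0 : (B : F[X]) ≠ 0 := nonZeroDivisors.ne_zero B.2
    have hcB : c * algebraMap F[X] _ (B : F[X]) = algebraMap F[X] _ A := by
      rw [← hcAB, IsLocalization.mk'_spec]
    have hdvd : (B : F[X]) ∣ δ B := by
      have h1 := congrArg D hcB
      rw [show D (c * algebraMap F[X] _ (B : F[X])) = _ from deriv_mul _ _] at h1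
      change c * D _ + _ * D c = _ at h1
      rw [hc, hD, hD, mul_zero, add_zero] at h1
      have h2 : A * δ B = δ A * B := by
        apply hinj
        rw [map_mul, map_mul, ← hcB, ← h1]
        ring
      exact hAB.symm.dvd_of_dvd_mul_left (h2 ▸ dvd_mul_left _ _)
    -- the denominator is normalized to be monic, so that its derivative has a smaller degree
    set u := C (B : F[X]).leadingCoeff⁻¹ with hu
    have hu0 : IsUnit u := by
      simp [hu, hB0]
    have hmonic : (u * B).Monic := by
      rw [mul_comm]
      exact monic_mul_leadingCoeff_inv hB0
    have hdvd' : u * B ∣ δ (u * B) := by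
      rw [hδmul]
      refine dvd_add (mul_dvd_mul_left _ hdvd) ?_
      rw [hu0.mul_left_dvd]
      exact dvd_mul_right _ _
    have hzero : δ (u * B) = 0 := by
      by_contra hne
      exact absurd (degree_le_of_dvd hdvd' hne) (not_le.mpr (degree_implicitDeriv_lt g hmonic))
    obtain ⟨b, hb⟩ := hconst _ hzero
    have hb1 : u * B = 1 := by
      rw [hb] at hmonic ⊢
      rw [show b = 1 by simpa using hmonic.leadingCoeff, map_one]
    have hcA : c = algebraMap F[X] _ (u * A) := by
      rw [map_mul, ← hcB, mul_left_comm, ← map_mul, hb1, map_one, mul_one]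
    rw [hcA, hD] at hc
    obtain ⟨a, ha⟩ := hconst (u * A) (hinj (by rw [hc, map_zero]))
    exact ⟨a, by rw [hcA, ha, hmap]⟩
  · change D _ = _
    rw [hD, hδX, hmap]

/-- Every element of a differential field has a primitive in some extension without new
constants. -/
theorem exists_extension_primitive [CharZero F] (g : F) :
    ∃ (F' : Type u) (_ : Field F') (_ : Differential F') (_ : Algebra F F')
      (_ : DifferentialAlgebra F F') (_ : Differential.ContainConstants F F') (x : F'),
      x′ = algebraMap F F' g := by
  by_cases hg : ∃ x : F, x′ = g
  · obtain ⟨x, hx⟩ := hg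
    exact ⟨F, inferInstance, inferInstance, inferInstance, inferInstance, inferInstance, x, hx⟩
  · exact exists_extension_primitive_of_not_exists hg

end Primitive

/-! ### Extensions with a full system of solutions -/

section Tower

variable (K F E : Type u) [Field K] [Differential K] [Field F] [Differential F] [Field E]
  [Differential E] [Algebra K F] [Algebra F E] [Algebra K E] [IsScalarTower K F E]

lemma differentialAlgebra_trans [DifferentialAlgebra K F] [DifferentialAlgebra F E] :
    DifferentialAlgebra K E :=
  ⟨fun a => by
    rw [IsScalarTower.algebraMap_apply K F E, deriv_algebraMap, deriv_algebraMap,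
      ← IsScalarTower.algebraMap_apply]⟩

omit [Differential K] in
lemma containConstants_trans [DifferentialAlgebra F E]
    [Differential.ContainConstants K F] [Differential.ContainConstants F E] :
    Differential.ContainConstants K E :=
  ⟨fun {x} hx => by
    obtain ⟨y, rfl⟩ := mem_range_of_deriv_eq_zero F hx
    rw [deriv_algebraMap, map_eq_zero] at hx
    obtain ⟨a, rfl⟩ := mem_range_of_deriv_eq_zero K hx
    exact ⟨a, IsScalarTower.algebraMap_apply K F E a⟩⟩

end Tower

namespace DiffOp

variable {K F : Type u} [Field K] [Differential K] [Field F] [Differential F] [Algebra K F]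
  [DifferentialAlgebra K F]

lemma map_derivComp (M : DiffOp K) :
    (derivComp M).map (algebraMap K F) = derivComp (M.map (algebraMap K F)) := by
  ext i
  cases i with
  | zero => simp [derivComp, deriv_algebraMap]
  | succ i => simp [derivComp, coeff_X_mul, deriv_algebraMap]

lemma map_comp (L M : DiffOp K) : (comp L M).map (algebraMap K F) =
    comp (L.map (algebraMap K F)) (M.map (algebraMap K F)) := by
  have key : ∀ i, (derivComp^[i] M).map (algebraMap K F) =
      derivComp^[i] (M.map (algebraMap K F)) := by
    intro i
    induction i with
    | zero => rfl
    | succ i ih =>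
      rw [Function.iterate_succ_apply', Function.iterate_succ_apply', map_derivComp, ih]
  induction L using Polynomial.induction_on' with
  | add p q hp hq => simp only [Polynomial.map_add, add_comp, hp, hq]
  | monomial n b =>
    rw [map_monomial, monomial_comp, monomial_comp, Polynomial.map_mul, map_C, key]

lemma map_prodLinear {n : ℕ} (p : Fin n → K) :
    (prodLinear p).map (algebraMap K F) = prodLinear fun i => algebraMap K F (p i) := by
  induction n with
  | zero => simp [prodLinear]
  | succ n ih =>
    rw [prodLinear_succ, prodLinear_succ, map_comp, ih]
    simp

end DiffOp

section FullSystem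

/-- The equation `(D - p_n) ⋯ (D - p_1) f = h` is solved by `n` successive primitives once the
equations `z_i′ = p_i z_i` have nonzero solutions. -/
theorem exists_extension_solution (n : ℕ) {F : Type u} [Field F] [CharZero F] [Differential F]
    (p z : Fin n → F) (hz : ∀ i, z i ≠ 0) (hzp : ∀ i, (z i)′ = p i * z i) (h : F) :
    ∃ (F' : Type u) (_ : Field F') (_ : Differential F') (_ : Algebra F F')
      (_ : DifferentialAlgebra F F') (_ : Differential.ContainConstants F F') (f : F'),
      (DiffOp.prodLinear p).apply f = algebraMap F F' h := by
  induction n generalizing F with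
  | zero =>
    exact ⟨F, inferInstance, inferInstance, inferInstance, inferInstance, inferInstance, h,
      by simp [DiffOp.prodLinear, DiffOp.one_apply]⟩
  | succ n ih =>
    obtain ⟨F₁, _, _, _, _, _, x, hx⟩ := exists_extension_primitive (h / z (Fin.last n))
    have : CharZero F₁ := charZero_of_injective_algebraMap (algebraMap F F₁).injective
    obtain ⟨F₂, _, _, _, _, _, f, hf⟩ := ih (fun i => algebraMap F F₁ (p i.castSucc))
      (fun i => algebraMap F F₁ (z i.castSucc)) (fun i => by simpa using hz _)
      (fun i => by rw [deriv_algebraMap, hzp, map_mul]) (algebraMap F F₁ (z (Fin.last n)) * x)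
    let _ : Algebra F F₂ := ((algebraMap F₁ F₂).comp (algebraMap F F₁)).toAlgebra
    have : IsScalarTower F F₁ F₂ := IsScalarTower.of_algebraMap_eq fun _ => rfl
    have : DifferentialAlgebra F F₂ := differentialAlgebra_trans F F₁ F₂
    refine ⟨F₂, inferInstance, inferInstance, inferInstance, inferInstance,
      containConstants_trans F F₁ F₂, f, ?_⟩
    rw [← DiffOp.map_prodLinear, DiffOp.apply_map] at hf
    rw [DiffOp.prodLinear_succ, DiffOp.comp_apply, hf, DiffOp.X_sub_C_apply, deriv_algebraMap,
      IsScalarTower.algebraMap_apply F F₁ F₂, IsScalarTower.algebraMap_apply F F₁ F₂, ← map_mul,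
      ← map_sub]
    congr 1
    rw [Derivation.leibniz, hx, deriv_algebraMap, hzp]
    have hz0 : algebraMap F F₁ (z (Fin.last n)) ≠ 0 := by simpa using hz _
    simp only [smul_eq_mul, map_mul, map_div₀]
    field_simp
    ring

/-- An element that the first `i - 1` factors map to `z_i` is annihilated by the first `i` factors
and is independent of the elements chosen before it. -/
theorem exists_extension_solutions (n : ℕ) {F : Type u} [Field F] [CharZero F] [Differential F]
    (p z : Fin n → F) (hz : ∀ i, z i ≠ 0) (hzp : ∀ i, (z i)′ = p i * z i) :
    ∃ (F' : Type u) (_ : Field F') (_ : Differential F') (_ : Algebra F F')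
      (_ : DifferentialAlgebra F F') (_ : Differential.ContainConstants F F') (f : Fin n → F'),
      LinearIndependent (constants F') f ∧ ∀ i, (DiffOp.prodLinear p).apply (f i) = 0 := by
  induction n with
  | zero =>
    exact ⟨F, inferInstance, inferInstance, inferInstance, inferInstance, inferInstance,
      Fin.elim0, linearIndependent_empty_type, fun i => i.elim0⟩
  | succ n ih =>
    obtain ⟨F₁, _, _, _, _, _, f, hf, hfs⟩ := ih (fun i => p i.castSucc)
      (fun i => z i.castSucc) (fun i => hz _) (fun i => hzp _)
    have : CharZero F₁ := charZero_of_injective_algebraMap (algebraMap F F₁).injective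
    obtain ⟨F₂, _, _, _, _, _, g, hg⟩ := exists_extension_solution n
      (fun i => algebraMap F F₁ (p i.castSucc)) (fun i => algebraMap F F₁ (z i.castSucc))
      (fun i => by simpa using hz _) (fun i => by rw [deriv_algebraMap, hzp, map_mul])
      (algebraMap F F₁ (z (Fin.last n)))
    let _ : Algebra F F₂ := ((algebraMap F₁ F₂).comp (algebraMap F F₁)).toAlgebra
    have : IsScalarTower F F₁ F₂ := IsScalarTower.of_algebraMap_eq fun _ => rfl
    have : DifferentialAlgebra F F₂ := differentialAlgebra_trans F F₁ F₂
    rw [← DiffOp.map_prodLinear, DiffOp.apply_map, ← IsScalarTower.algebraMap_apply] at hg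
    have hs : ∀ i, (DiffOp.prodLinear fun i : Fin n => p i.castSucc).apply
        (algebraMap F₁ F₂ (f i)) = 0 := fun i => by
      rw [DiffOp.apply_algebraMap, hfs, map_zero]
    refine ⟨F₂, inferInstance, inferInstance, inferInstance, inferInstance,
      containConstants_trans F F₁ F₂, Fin.snoc (fun i => algebraMap F₁ F₂ (f i)) g, ?_, ?_⟩
    · rw [linearIndependent_finSnoc]
      refine ⟨linearIndependent_constants_iff.mp (hf.map'
        ((Algebra.linearMap F₁ F₂).restrictScalars (constants F₁)) ?_), fun hmem => ?_⟩
      · exact LinearMap.ker_eq_bot.mpr (algebraMap F₁ F₂).injective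
      · have hle : Submodule.span (constants F₂)
            (Set.range fun i => algebraMap F₁ F₂ (f i)) ≤
              solutions ((DiffOp.prodLinear fun i : Fin n => p i.castSucc).map
                (algebraMap F F₂)) := by
          rw [Submodule.span_le]
          rintro _ ⟨i, rfl⟩
          change DiffOp.apply _ _ = 0
          rw [DiffOp.apply_map, hs]
        have h0 := hle hmem
        rw [mem_solutions, DiffOp.apply_map, hg, map_eq_zero] at h0
        exact hz _ h0
    · intro i
      rw [DiffOp.prodLinear_succ, DiffOp.comp_apply]
      induction i using Fin.lastCases with
      | last =>
        rw [Fin.snoc_last, hg, DiffOp.X_sub_C_apply, deriv_algebraMap, hzp, map_mul, sub_self]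
      | cast i => rw [Fin.snoc_castSucc, hs, DiffOp.apply_zero]

end FullSystem

/-! ### Towers of exponentials and integrals inside a fixed field -/

section AdmissibleIn

variable {K E : Type u} [Field K] [Differential K] [Field E] [Differential E] [Algebra K E]
  [DifferentialAlgebra K E]

/-- The intermediate fields reached from `K` by adjoining, one at a time, transcendental elements
`y` with `y′ = p y` or `y′ = p y²`, where `p` lies in the field reached before.  Such `y` are
exponentials of integrals and reciprocals of integrals. -/
inductive AdmissibleIn : IntermediateField K E → Prop
  | bot : AdmissibleIn ⊥
  | adjoin (N : IntermediateField K E) (y p : E) (hN : AdmissibleIn N) (hp : p ∈ N)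
      (hy : Transcendental N y) (h : y′ = p * y ∨ y′ = p * y ^ 2) : AdmissibleIn (diffAdjoin N y)

lemma AdmissibleIn.deriv_mem {N : IntermediateField K E} (hN : AdmissibleIn N) :
    ∀ x ∈ N, x′ ∈ N := by
  cases hN with
  | bot => exact deriv_mem_bot
  | adjoin N y => exact deriv_mem_diffAdjoin N y

omit [Differential K] [DifferentialAlgebra K E] in
lemma isSpecialTranscendental_of_deriv_eq {N : IntermediateField K E} {y p : E} (hp : p ∈ N)
    (hy : Transcendental N y) (h : y′ = p * y ∨ y′ = p * y ^ 2) : IsSpecialTranscendental N y := by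
  refine ⟨hy, ?_⟩
  rcases h with h | h
  · exact ⟨C ⟨p, hp⟩, 1, isCoprime_one_right, by
      rw [h, map_one, div_one, map_mul, aeval_X, aeval_C, mul_comm]; rfl⟩
  · exact ⟨C ⟨p, hp⟩ * X, 1, isCoprime_one_right, by
      rw [h, map_one, div_one, map_mul, map_mul, aeval_X, aeval_C, pow_two]
      change p * (y * y) = y * (p * y)
      ring⟩

/-- `N` is the last field of a chain of simple extensions by special transcendental elements. -/
def IsChainTop (N : IntermediateField K E) : Prop :=
  ∃ (m : ℕ) (M : Fin (m + 1) → IntermediateField K E),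
    M 0 = ⊥ ∧ M (Fin.last m) = N ∧
      ∀ i : Fin m, ∃ y : E, IsSpecialTranscendental (M i.castSucc) y ∧
        M i.succ = diffAdjoin (M i.castSucc) y

omit [Differential K] [DifferentialAlgebra K E] in
lemma isChainTop_bot : IsChainTop (⊥ : IntermediateField K E) :=
  ⟨0, fun _ => ⊥, rfl, rfl, fun i => i.elim0⟩

omit [Differential K] [DifferentialAlgebra K E] in
lemma IsChainTop.diffAdjoin {N : IntermediateField K E} (hN : IsChainTop N) {y : E}
    (hy : IsSpecialTranscendental N y) : IsChainTop (diffAdjoin N y) := by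
  obtain ⟨m, M, h0, hlast, hstep⟩ := hN
  refine ⟨m + 1, Fin.snoc (α := fun _ => IntermediateField K E) M (DiffField.diffAdjoin N y),
    ?_, ?_, ?_⟩
  · rw [← h0, ← Fin.castSucc_zero, Fin.snoc_castSucc]
  · rw [Fin.snoc_last]
  · intro i
    induction i using Fin.lastCases with
    | last =>
      rw [Fin.succ_last, Fin.snoc_last, Fin.snoc_castSucc, hlast]
      exact ⟨y, hy, rfl⟩
    | cast i =>
      rw [Fin.succ_castSucc, Fin.snoc_castSucc, Fin.snoc_castSucc]
      exact hstep i

omit [Differential K] [DifferentialAlgebra K E] in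
/-- A tower inside `E` that ends below `N'` is a tower inside `N'`. -/
lemma AdmissibleIn.isChainTop_comap {N' : IntermediateField K E} (hN' : ∀ x ∈ N', x′ ∈ N')
    {N : IntermediateField K E} (hN : AdmissibleIn N) (hle : N ≤ N') :
    letI := differentialOfClosed N' hN'
    IsChainTop (N.comap N'.val) := by
  let _ : Differential N' := differentialOfClosed N' hN'
  induction hN with
  | bot =>
    convert isChainTop_bot (K := K) (E := N') using 1
    rw [eq_bot_iff]
    rintro x hx
    obtain ⟨a, ha⟩ := IntermediateField.mem_bot.mp
      (show (x : E) ∈ (⊥ : IntermediateField K E) from hx)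
    exact IntermediateField.mem_bot.mpr ⟨a, Subtype.ext ha⟩
  | adjoin N y p hN hp hy h ih =>
    have hNN' : N ≤ N' := (le_diffAdjoin N y).trans hle
    have hyN' : y ∈ N' := hle (mem_diffAdjoin_self N y)
    have hy' : Transcendental (N.comap N'.val) (⟨y, hyN'⟩ : N') := by
      intro halg
      refine hy (halg.ringHom_of_comp_eq
        (f := ({ toFun := fun x => ⟨((x : N') : E), x.2⟩
                 map_one' := rfl
                 map_mul' := fun _ _ => rfl
                 map_zero' := rfl
                 map_add' := fun _ _ => rfl } : N.comap N'.val →+* N))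
        (g := (N'.val : N' →+* E)) ?_ ?_)
      · intro a b hab
        exact Subtype.ext (Subtype.ext (congrArg (fun t : N => (t : E)) hab))
      · rfl
    have hspec : IsSpecialTranscendental (N.comap N'.val) (⟨y, hyN'⟩ : N') :=
      isSpecialTranscendental_of_deriv_eq (p := ⟨p, hNN' hp⟩) hp hy'
        (h.imp (fun h => Subtype.ext h) fun h => Subtype.ext h)
    have heq : (diffAdjoin N y).comap N'.val = diffAdjoin (N.comap N'.val) (⟨y, hyN'⟩ : N') := by
      apply le_antisymm
      · have h1 : diffAdjoin N y ≤
            (diffAdjoin (N.comap N'.val) (⟨y, hyN'⟩ : N')).map N'.val := by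
          refine diffAdjoin_le ?_ ⟨⟨y, hyN'⟩, mem_diffAdjoin_self _ _, rfl⟩ ?_
          · intro a ha
            exact ⟨⟨a, hNN' ha⟩, le_diffAdjoin _ _ ha, rfl⟩
          · rintro _ ⟨a, ha, rfl⟩
            exact ⟨a′, deriv_mem_diffAdjoin _ _ a ha, rfl⟩
        intro x hx
        obtain ⟨a, ha, hax⟩ := h1 hx
        rwa [← show a = x from Subtype.ext hax]
      · refine diffAdjoin_le ?_ (mem_diffAdjoin_self N y) ?_
        · intro a ha
          exact le_diffAdjoin N y ha
        · intro a ha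
          exact deriv_mem_diffAdjoin N y _ ha
    rw [heq]
    exact (ih hNN').diffAdjoin hspec

lemma AdmissibleIn.isAdmissible {N : IntermediateField K E} (hN : AdmissibleIn N) :
    letI := differentialOfClosed N hN.deriv_mem
    IsAdmissible K N := by
  let _ : Differential N := differentialOfClosed N hN.deriv_mem
  have h := hN.isChainTop_comap hN.deriv_mem le_rfl
  have htop : N.comap N.val = ⊤ := eq_top_iff.mpr fun x _ => x.2
  rw [htop] at h
  exact h

variable [CharZero K] [Differential.ContainConstants K E]

omit [Differential K] [DifferentialAlgebra K E] in
/-- An integral that is algebraic over a differential field without new constants lies in it. -/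
lemma mem_of_isAlgebraic_of_deriv_mem {N : IntermediateField K E} (hN : ∀ x ∈ N, x′ ∈ N) {x : E}
    (hx : IsAlgebraic N x) (hx' : x′ ∈ N) : x ∈ N := by
  let _ : Differential N := differentialOfClosed N hN
  have := differentialAlgebra_of_closed N hN
  have : CharZero N := charZero_of_injective_algebraMap (algebraMap K N).injective
  set g : N := ⟨x′, hx'⟩ with hg
  have hint := hx.isIntegral
  have h0 : Differential.implicitDeriv (C g) (minpoly N x) = 0 := by
    by_contra hne
    have hle := minpoly.degree_le_of_ne_zero N x hne (by
      rw [← Differential.deriv_aeval_eq_implicitDeriv x (C g) (by rw [aeval_C]; rfl),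
        minpoly.aeval, map_zero])
    exact absurd hle (not_le.mpr (degree_implicitDeriv_lt g (minpoly.monic hint)))
  obtain ⟨h, hh⟩ := exists_primitive_of_implicitDeriv_eq_zero (minpoly.natDegree_pos hint).ne' h0
  have hc : (x - h)′ = 0 := by
    rw [map_sub, show ((h : E))′ = x′ from congrArg Subtype.val hh, sub_self]
  obtain ⟨c, hc⟩ := mem_range_of_deriv_eq_zero K hc
  rw [← sub_add_cancel x (h : E), ← hc]
  exact add_mem (N.algebraMap_mem c) h.2

/-- An integral over a tower lies in a longer tower. -/
lemma AdmissibleIn.exists_mem_of_deriv_mem {N : IntermediateField K E} (hN : AdmissibleIn N)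
    {x : E} (hx' : x′ ∈ N) : ∃ N₂, N ≤ N₂ ∧ AdmissibleIn N₂ ∧ x ∈ N₂ := by
  by_cases hx : IsAlgebraic N x
  · exact ⟨N, le_rfl, hN, mem_of_isAlgebraic_of_deriv_mem hN.deriv_mem hx hx'⟩
  -- the reciprocal of an integral is special: `(1/x)′ = -x′ (1/x)²`
  refine ⟨diffAdjoin N x⁻¹, le_diffAdjoin _ _, .adjoin N x⁻¹ (-x′) hN (neg_mem hx')
    (fun h => hx (IsAlgebraic.inv_iff.mp h)) (Or.inr ?_), ?_⟩
  · rw [Derivation.leibniz_inv]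
    simp only [smul_eq_mul, inv_pow]
    ring
  · simpa using inv_mem (mem_diffAdjoin_self N x⁻¹)

/-- A solution `g` of `g′ - p g = h` is obtained from the exponential `z` with `z′ = p z` by the
integral `g / z` of `h / z`; this is applied to the factors from the left. -/
lemma AdmissibleIn.exists_mem_of_prodLinear_mem {n : ℕ} {p : Fin n → K} {z : Fin n → E}
    (hz : ∀ i, z i ≠ 0) (hzp : ∀ i, (z i)′ = algebraMap K E (p i) * z i)
    {N : IntermediateField K E} (hN : AdmissibleIn N) (hzN : ∀ i, z i ∈ N) {f : E}
    (hf : (DiffOp.prodLinear p).apply f ∈ N) : ∃ N₂, N ≤ N₂ ∧ AdmissibleIn N₂ ∧ f ∈ N₂ := by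
  induction n generalizing N with
  | zero => exact ⟨N, le_rfl, hN, by simpa [DiffOp.prodLinear, DiffOp.one_apply] using hf⟩
  | succ n ih =>
    set g := (DiffOp.prodLinear fun i : Fin n => p i.castSucc).apply f with hg
    set y := z (Fin.last n) with hy
    have hy0 : y ≠ 0 := hz _
    rw [DiffOp.prodLinear_succ, DiffOp.comp_apply, DiffOp.X_sub_C_apply, ← hg] at hf
    have hd : (g / y)′ = (g′ - algebraMap K E (p (Fin.last n)) * g) / y := by
      rw [Derivation.leibniz_div, hy, hzp, ← hy]
      simp only [smul_eq_mul]
      field_simp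
    obtain ⟨N₁, hle₁, hN₁, hmem⟩ := hN.exists_mem_of_deriv_mem (x := g / y) (by
      rw [hd]
      exact N.div_mem hf (hzN _))
    have hgN : g ∈ N₁ := by
      rw [← div_mul_cancel₀ g hy0]
      exact mul_mem hmem (hle₁ (hzN _))
    obtain ⟨N₂, hle₂, hN₂, hfN⟩ := ih (fun i => hz _) (fun i => hzp _) hN₁
      (fun i => hle₁ (hzN _)) hgN
    exact ⟨N₂, hle₁.trans hle₂, hN₂, hfN⟩

lemma AdmissibleIn.exists_forall_mem {n m : ℕ} {p : Fin n → K} {z : Fin n → E}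
    (hz : ∀ i, z i ≠ 0) (hzp : ∀ i, (z i)′ = algebraMap K E (p i) * z i)
    {N : IntermediateField K E} (hN : AdmissibleIn N) (hzN : ∀ i, z i ∈ N) (f : Fin m → E)
    (hf : ∀ i, (DiffOp.prodLinear p).apply (f i) = 0) :
    ∃ N₂ : IntermediateField K E, AdmissibleIn N₂ ∧ ∀ i, f i ∈ N₂ := by
  suffices ∀ s : Finset (Fin m), ∃ N₂ : IntermediateField K E,
      N ≤ N₂ ∧ AdmissibleIn N₂ ∧ ∀ i ∈ s, f i ∈ N₂ by
    obtain ⟨N₂, -, h, hs⟩ := this Finset.univ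
    exact ⟨N₂, h, fun i => hs i (Finset.mem_univ i)⟩
  intro s
  induction s using Finset.induction_on with
  | empty => exact ⟨N, le_rfl, hN, by simp⟩
  | insert a s ha ih =>
    obtain ⟨N₁, hle₁, hN₁, hs⟩ := ih
    obtain ⟨N₂, hle₂, hN₂, hmem⟩ := hN₁.exists_mem_of_prodLinear_mem hz hzp
      (fun i => hle₁ (hzN i)) (f := f a) (by rw [hf]; exact zero_mem _)
    refine ⟨N₂, hle₁.trans hle₂, hN₂, fun i hi => ?_⟩
    rcases Finset.mem_insert.mp hi with rfl | hi
    · exact hmem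
    · exact hle₂ (hs i hi)

end AdmissibleIn

/-! ### Exponentials -/

section Exponentials

variable {K F : Type u} [Field K] [Differential K] [Field F] [Differential F] [Algebra K F]
  [DifferentialAlgebra K F]

/-- Exponentials of integrals from pairwise distinct classes modulo `K` are linearly independent
over `K`: differentiating a shortest relation makes it shorter. -/
lemma linearIndependent_of_exponentials [Differential.ContainConstants K F] {ι : Type*}
    {g : ι → F} {q : ι → K} (hg : ∀ i, g i ≠ 0) (hq : ∀ i, (g i)′ = algebraMap K F (q i) * g i)
    (h : ∀ i j, i ≠ j → g i / g j ∉ (algebraMap K F).range) : LinearIndependent K g := by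
  classical
  rw [linearIndependent_iff']
  intro s
  induction s using Finset.induction_on with
  | empty => simp
  | insert i₀ s hi₀ ih =>
    intro a ha
    by_cases ha0 : a i₀ = 0
    · rw [Finset.sum_insert hi₀, ha0, zero_smul, zero_add] at ha
      intro i hi
      rcases Finset.mem_insert.mp hi with rfl | hi
      · exact ha0
      · exact ih a ha i hi
    exfalso
    set b : ι → K := fun i => a i / a i₀ with hb
    have hrel : g i₀ + ∑ i ∈ s, algebraMap K F (b i) * g i = 0 := by
      have h1 : algebraMap K F (a i₀) ≠ 0 := by simpa using ha0
      rw [Finset.sum_insert hi₀] at ha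
      simp only [Algebra.smul_def] at ha
      apply mul_left_cancel₀ h1
      rw [mul_zero, ← ha, mul_add, Finset.mul_sum]
      congr 1
      refine Finset.sum_congr rfl fun i _ => ?_
      rw [hb, ← mul_assoc, ← map_mul, mul_div_cancel₀ _ ha0]
    have hrel' : algebraMap K F (q i₀) * g i₀ +
        ∑ i ∈ s, algebraMap K F ((b i)′ + b i * q i) * g i = 0 := by
      have h1 := congrArg (fun x : F => x′) hrel
      simp only [map_add, map_sum, map_zero, hq, Derivation.leibniz, smul_eq_mul,
        deriv_algebraMap] at h1
      rw [← h1]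
      congr 1
      refine Finset.sum_congr rfl fun i _ => ?_
      simp only [map_add, map_mul]
      ring
    have hsum : ∑ i ∈ s, ((b i)′ + b i * q i - q i₀ * b i) • g i = 0 := by
      have h1 : ∑ i ∈ s, ((b i)′ + b i * q i - q i₀ * b i) • g i =
          (algebraMap K F (q i₀) * g i₀ +
            ∑ i ∈ s, algebraMap K F ((b i)′ + b i * q i) * g i) -
          algebraMap K F (q i₀) * (g i₀ + ∑ i ∈ s, algebraMap K F (b i) * g i) := by
        rw [mul_add, Finset.mul_sum, add_sub_add_left_eq_sub, ← Finset.sum_sub_distrib]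
        refine Finset.sum_congr rfl fun i _ => ?_
        rw [Algebra.smul_def, map_sub, map_mul]
        ring
      rw [h1, hrel, hrel', mul_zero, sub_zero]
    have hb0 : ∀ i ∈ s, b i = 0 := by
      intro i hi
      by_contra hbi
      have h1 := ih _ hsum i hi
      have hc : (algebraMap K F (b i) * g i / g i₀)′ = 0 := by
        rw [Derivation.leibniz_div, Derivation.leibniz, hq, hq, deriv_algebraMap,
          show (b i)′ = q i₀ * b i - b i * q i by linear_combination h1]
        simp only [smul_eq_mul, map_sub, map_mul]
        ring
      obtain ⟨c, hc⟩ := mem_range_of_deriv_eq_zero K hc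
      refine h i i₀ (by rintro rfl; exact hi₀ hi) ⟨c / b i, ?_⟩
      have hbi' : algebraMap K F (b i) ≠ 0 := by simpa using hbi
      rw [map_div₀, hc]
      field_simp
    rw [Finset.sum_eq_zero fun i hi => by rw [hb0 i hi, map_zero, zero_mul], add_zero] at hrel
    exact hg i₀ hrel

/-- Exponentials of integrals without a multiplicative relation modulo `K` are algebraically
independent over `K`, as their monomials are linearly independent. -/
lemma algebraicIndependent_of_exponentials [Differential.ContainConstants K F] {r : ℕ}
    {w : Fin r → Fˣ} {q : Fin r → K} (hq : ∀ i, ((w i : F))′ = algebraMap K F (q i) * w i)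
    (h : ∀ j : Fin r → ℤ, ∏ i, w i ^ j i ∈ (Units.map (algebraMap K F : K →* F)).range → j = 0) :
    AlgebraicIndependent K fun i => (w i : F) := by
  set g : (Fin r →₀ ℕ) → F := fun m => ((∏ i, w i ^ m i : Fˣ) : F) with hg
  have hlin : LinearIndependent K g := by
    refine linearIndependent_of_exponentials (q := fun m => ∑ i, (m i : K) * q i)
      (fun m => Units.ne_zero _) (fun m => ?_) fun m m' hmm' hmem => hmm' ?_
    · have h1 := Differential.logDeriv_prod (Fin r) Finset.univ (fun i => (w i : F) ^ m i)
        fun i _ => pow_ne_zero _ (Units.ne_zero _)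
      have h2 : ∀ i, Differential.logDeriv (w i : F) = algebraMap K F (q i) := fun i => by
        rw [Differential.logDeriv, hq, mul_div_cancel_right₀ _ (Units.ne_zero _)]
      simp only [Differential.logDeriv_pow, h2] at h1
      have h3 : (∏ i, (w i : F) ^ m i) ≠ 0 :=
        Finset.prod_ne_zero_iff.mpr fun i _ => pow_ne_zero _ (Units.ne_zero _)
      rw [Differential.logDeriv, div_eq_iff h3] at h1
      simpa [hg] using h1
    · obtain ⟨a, ha⟩ := hmem
      have ha0 : a ≠ 0 := by
        rintro rfl
        rw [map_zero] at ha
        exact div_ne_zero (Units.ne_zero _) (Units.ne_zero _) ha.symm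
      have h1 := h (fun i => (m i : ℤ) - m' i) ⟨Units.mk0 a ha0, Units.ext (by
        simp only [zpow_sub, zpow_natCast, Finset.prod_mul_distrib, Finset.prod_inv_distrib]
        rw [← div_eq_mul_inv, Units.val_div_eq_div_val]
        exact ha)⟩
      ext i
      have h2 := congrFun h1 i
      simp only [Pi.zero_apply] at h2
      omega
  have hbasis : ∀ m, MvPolynomial.aeval (fun i => (w i : F))
      (MvPolynomial.basisMonomials (Fin r) K m) = g m := fun m => by
    simp [hg, MvPolynomial.aeval_monomial, Finsupp.prod_fintype]
  rw [algebraicIndependent_iff_injective_aeval]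
  have h1 : LinearIndependent K
      ((MvPolynomial.aeval (R := K) fun i => (w i : F)).toLinearMap ∘
        MvPolynomial.basisMonomials (Fin r) K) := by
    convert hlin using 1
    exact funext hbasis
  exact LinearMap.injective_of_linearIndependent
    (MvPolynomial.basisMonomials (Fin r) K).span_eq h1

lemma deriv_mem_adjoin_of_exponentials {S : Set F}
    (hS : ∀ x ∈ S, ∃ q : K, x′ = algebraMap K F q * x) :
    ∀ x ∈ IntermediateField.adjoin K S, x′ ∈ IntermediateField.adjoin K S := by
  intro x hx
  induction hx using IntermediateField.adjoin_induction with
  | mem x hx =>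
    obtain ⟨q, hq⟩ := hS x hx
    rw [hq]
    exact mul_mem (IntermediateField.algebraMap_mem _ q) (IntermediateField.subset_adjoin K S hx)
  | algebraMap a =>
    rw [deriv_algebraMap]
    exact IntermediateField.algebraMap_mem _ _
  | add x y _ _ hx hy => rw [map_add]; exact add_mem hx hy
  | inv x hx ih =>
    rw [← one_div]
    exact deriv_div_mem _ (one_mem _) hx (by simp) ih
  | mul x y hx hy hx' hy' =>
    rw [Derivation.leibniz]
    exact add_mem (mul_mem hx hy') (mul_mem hy hx')

lemma admissibleIn_adjoin_of_exponentials {r : ℕ} {w : Fin r → F} {q : Fin r → K}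
    (hq : ∀ i, (w i)′ = algebraMap K F (q i) * w i) (hw : AlgebraicIndependent K w) :
    AdmissibleIn (IntermediateField.adjoin K (Set.range w)) := by
  suffices ∀ s : Finset (Fin r), AdmissibleIn (IntermediateField.adjoin K (w '' s)) by
    simpa using this Finset.univ
  intro s
  induction s using Finset.induction_on with
  | empty => simpa using AdmissibleIn.bot
  | insert i s hi ih =>
    have htr : Transcendental (IntermediateField.adjoin K (w '' s)) (w i) :=
      IntermediateField.transcendental_adjoin_iff.mpr (hw.transcendental_adjoin (by simpa using hi))
    have hstep := AdmissibleIn.adjoin _ (w i) (algebraMap K F (q i)) ih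
      (IntermediateField.algebraMap_mem _ _) htr (Or.inl (hq i))
    convert hstep using 1
    apply le_antisymm
    · rw [IntermediateField.adjoin_le_iff, Finset.coe_insert, Set.image_insert_eq,
        Set.insert_subset_iff]
      exact ⟨mem_diffAdjoin_self _ _,
        (IntermediateField.subset_adjoin K _).trans (le_diffAdjoin _ _)⟩
    · refine diffAdjoin_le (IntermediateField.adjoin.mono _ _ _ (Set.image_mono (by simp)))
        (IntermediateField.subset_adjoin K _ ⟨i, by simp, rfl⟩)
        (deriv_mem_adjoin_of_exponentials ?_)
      rintro _ ⟨j, -, rfl⟩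
      exact ⟨q j, hq j⟩

end Exponentials

/-! ### Finitely generated groups with torsion-free quotients -/

/-- A finitely generated subgroup `G` of a commutative group with `G / (G ∩ H)` torsion free is
generated modulo `H` by finitely many elements that are independent modulo `H`. -/
lemma exists_independent_generators {A : Type*} [CommGroup A] (H G : Subgroup A) [Group.FG G]
    [IsMulTorsionFree (G ⧸ H.subgroupOf G)] :
    ∃ (r : ℕ) (w : Fin r → A), (∀ i, w i ∈ G) ∧
      (∀ j : Fin r → ℤ, ∏ i, w i ^ j i ∈ H → j = 0) ∧
      ∀ g ∈ G, ∃ h ∈ H, ∃ j : Fin r → ℤ, g = h * ∏ i, w i ^ j i := by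
  have : Group.FG (G ⧸ H.subgroupOf G) := QuotientGroup.fg _
  have : Module.Finite ℤ (Additive (G ⧸ H.subgroupOf G)) :=
    Module.Finite.iff_addGroup_fg.mpr (GroupFG.iff_add_fg.mp this)
  let b := Module.finBasis ℤ (Additive (G ⧸ H.subgroupOf G))
  choose w hw using fun i => QuotientGroup.mk_surjective (b i).toMul
  have hprod : ∀ j : Fin _ → ℤ, (QuotientGroup.mk (∏ i, w i ^ j i) : G ⧸ H.subgroupOf G) =
      (∑ i, j i • b i).toMul := by
    intro j
    rw [toMul_sum, ← QuotientGroup.mk'_apply, map_prod]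
    refine Finset.prod_congr rfl fun i _ => ?_
    rw [map_zpow, QuotientGroup.mk'_apply, hw, toMul_zsmul]
  refine ⟨_, fun i => (w i : A), fun i => (w i).2, fun j hj => ?_, fun g hg => ?_⟩
  · have h1 : (QuotientGroup.mk (∏ i, w i ^ j i) : G ⧸ H.subgroupOf G) = 1 := by
      rw [QuotientGroup.eq_one_iff, Subgroup.mem_subgroupOf]
      simpa using hj
    rw [hprod] at h1
    have h2 : ∑ i, j i • b i = 0 := h1
    exact funext (Fintype.linearIndependent_iff.mp b.linearIndependent j h2)
  · set x : Additive (G ⧸ H.subgroupOf G) := Additive.ofMul (QuotientGroup.mk ⟨g, hg⟩) with hx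
    have h1 := hprod fun i => b.repr x i
    rw [b.sum_repr x, hx, toMul_ofMul, eq_comm, QuotientGroup.eq_iff_div_mem,
      Subgroup.mem_subgroupOf] at h1
    refine ⟨_, h1, fun i => b.repr x i, ?_⟩
    simp [hx]

/-! ### Constructing the admissible extension -/

section Construction

variable {K : Type u} [Field K] [Differential K]

omit [Differential K] in
lemma exists_logDeriv_of_mem_closure {F : Type u} [Field F] [Differential F] [Algebra K F]
    {n : ℕ} {z : Fin n → Fˣ} {p : Fin n → K}
    (hz : ∀ i, ((z i : F))′ = algebraMap K F (p i) * (z i : F)) {g : Fˣ}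
    (hg : g ∈ Subgroup.closure (Set.range z)) :
    ∃ q : K, ((g : F))′ = algebraMap K F q * (g : F) := by
  induction hg using Subgroup.closure_induction with
  | mem x hx =>
    obtain ⟨i, rfl⟩ := hx
    exact ⟨p i, hz i⟩
  | one => exact ⟨0, by simp⟩
  | mul x y _ _ hx hy =>
    obtain ⟨q, hq⟩ := hx
    obtain ⟨q', hq'⟩ := hy
    refine ⟨q + q', ?_⟩
    rw [Units.val_mul, Derivation.leibniz, hq, hq']
    simp only [smul_eq_mul, map_add]
    ring
  | inv x _ hx =>
    obtain ⟨q, hq⟩ := hx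
    refine ⟨-q, ?_⟩
    have hx0 : (x : F) ≠ 0 := x.ne_zero
    rw [Units.val_inv_eq_inv_val, Derivation.leibniz_inv, hq]
    simp only [smul_eq_mul, map_neg]
    field_simp

/-- The dimension bound shows that `n` independent solutions of an equation of order `n` span the
solutions in any extension without new constants. -/
lemma containsAllSolutions_of_linearIndependent {E : Type u} [Field E] [Differential E]
    [Algebra K E] [DifferentialAlgebra K E] [Differential.ContainConstants K E] {n : ℕ}
    {L : DiffOp K} (hL : L ≠ 0) (hn : L.natDegree = n) {v : Fin n → E}
    (hv : LinearIndependent (constants K) v) (hs : ∀ i, L.apply (v i) = 0) :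
    ContainsAllSolutions E n L := by
  refine ⟨⟨v, hv, hs⟩, ?_⟩
  intro F _ _ _ _ _ _ _ y hy
  have : DifferentialAlgebra K F := differentialAlgebra_trans K E F
  have : Differential.ContainConstants K F := containConstants_trans K E F
  have hvF : LinearIndependent (constants F) fun i => algebraMap E F (v i) :=
    linearIndependent_constants_iff.mp (hv.map'
      ((IsScalarTower.toAlgHom K E F).toLinearMap.restrictScalars (constants K))
      (LinearMap.ker_eq_bot.mpr (algebraMap E F).injective))
  by_cases hmem : y ∈ Submodule.span (constants F) (Set.range fun i => algebraMap E F (v i))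
  · clear hy
    induction hmem using Submodule.span_induction with
    | mem x hx =>
      obtain ⟨i, rfl⟩ := hx
      exact ⟨v i, rfl⟩
    | zero => exact zero_mem _
    | add x y _ _ hx hy => exact add_mem hx hy
    | smul c x _ hx => exact mul_mem (mem_range_of_deriv_eq_zero E c.2) hx
  · have h1 := card_le_of_linearIndependent_solutions (E := F) (n := n) (m := n + 1)
      (L := L.map (algebraMap K F)) (by simpa using hL) (by rw [natDegree_map, hn])
      (linearIndependent_finSnoc.mpr ⟨hvF, hmem⟩) (fun i => by
        rw [DiffOp.apply_map]
        induction i using Fin.lastCases with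
        | last => rw [Fin.snoc_last, hy]
        | cast i => rw [Fin.snoc_castSucc, DiffOp.apply_algebraMap, hs, map_zero])
    omega

/-- The exponentials that are independent modulo `K` are adjoined before any integral, so that they
are transcendental at each step. -/
theorem exists_admissible_of_factorization [CharZero K] {n : ℕ} {L : DiffOp K} (hL : L ≠ 0)
    (hn : L.natDegree = n) {F : Type u} [Field F] [Differential F] [Algebra K F]
    [DifferentialAlgebra K F] [Differential.ContainConstants K F] (p : Fin n → K) (z : Fin n → Fˣ)
    (hz : ∀ i, ((z i : F))′ = algebraMap K F (p i) * (z i : F))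
    (hLp : L = DiffOp.comp (C (L.coeff n)) (DiffOp.prodLinear p))
    (htf : TorsionFreeModBase (K := K) z) :
    ∃ (E : Type u) (_ : Field E) (_ : Differential E) (_ : Algebra K E)
        (_ : DifferentialAlgebra K E) (_ : Differential.ContainConstants K E),
        IsAdmissible K E ∧ ContainsAllSolutions E n L := by
  have : CharZero F := charZero_of_injective_algebraMap (algebraMap K F).injective
  obtain ⟨Ω, _, _, _, _, _, f, hf, hfs⟩ := exists_extension_solutions n
    (fun i => algebraMap K F (p i)) (fun i => (z i : F)) (fun i => Units.ne_zero _) hz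
  let _ : Algebra K Ω := ((algebraMap F Ω).comp (algebraMap K F)).toAlgebra
  have : IsScalarTower K F Ω := IsScalarTower.of_algebraMap_eq fun _ => rfl
  have : DifferentialAlgebra K Ω := differentialAlgebra_trans K F Ω
  have : Differential.ContainConstants K Ω := containConstants_trans K F Ω
  have hfs' : ∀ i, (DiffOp.prodLinear p).apply (f i) = 0 := fun i => by
    rw [← DiffOp.apply_map (F := F), DiffOp.map_prodLinear, hfs]
  have : IsMulTorsionFree (Subgroup.closure (Set.range z) ⧸
    (Units.map (algebraMap K F : K →* F)).range.subgroupOf (Subgroup.closure (Set.range z))) := htf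
  have : Group.FG (Subgroup.closure (Set.range z)) := Group.closure_finite_fg _
  obtain ⟨r, w, hwG, hwind, hwgen⟩ := exists_independent_generators
    (Units.map (algebraMap K F : K →* F)).range (Subgroup.closure (Set.range z))
  choose q hq using fun i => exists_logDeriv_of_mem_closure hz (hwG i)
  have hwalg : AlgebraicIndependent K fun i => algebraMap F Ω (w i) :=
    (algebraicIndependent_of_exponentials hq hwind).map'
      (f := IsScalarTower.toAlgHom K F Ω) (algebraMap F Ω).injective
  have hN := admissibleIn_adjoin_of_exponentials (q := q) (fun i => by
    rw [deriv_algebraMap, hq, map_mul, ← IsScalarTower.algebraMap_apply]) hwalg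
  set N₀ := IntermediateField.adjoin K (Set.range fun i => algebraMap F Ω (w i)) with hN₀
  have hzN : ∀ i, algebraMap F Ω (z i) ∈ N₀ := by
    intro i
    obtain ⟨_, ⟨a, rfl⟩, j, hj⟩ := hwgen (z i) (Subgroup.subset_closure ⟨i, rfl⟩)
    have h1 : algebraMap F Ω (z i) = algebraMap K Ω a * ∏ i, (algebraMap F Ω (w i)) ^ j i := by
      rw [hj, IsScalarTower.algebraMap_apply K F Ω]
      simp
    rw [h1]
    exact mul_mem (N₀.algebraMap_mem _) (prod_mem fun i _ => zpow_mem
      (IntermediateField.subset_adjoin K _ (Set.mem_range_self i)) _)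
  obtain ⟨N, hN, hfN⟩ := hN.exists_forall_mem (p := p) (z := fun i => algebraMap F Ω (z i))
    (fun i => by simp)
    (fun i => by rw [deriv_algebraMap, hz, map_mul, ← IsScalarTower.algebraMap_apply])
    hzN f hfs'
  let _ : Differential N := differentialOfClosed N hN.deriv_mem
  have : DifferentialAlgebra N Ω := differentialAlgebra_of_closed N hN.deriv_mem
  have : DifferentialAlgebra K N := differentialAlgebra_base_of_closed N hN.deriv_mem
  have : Differential.ContainConstants K N := ⟨fun {x} hx => by
    obtain ⟨a, ha⟩ := mem_range_of_deriv_eq_zero K (x := (x : Ω)) (congrArg Subtype.val hx)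
    exact ⟨a, Subtype.ext ha⟩⟩
  let v : Fin n → N := fun i => ⟨f i, hfN i⟩
  refine ⟨N, inferInstance, inferInstance, inferInstance, inferInstance, inferInstance,
    hN.isAdmissible, containsAllSolutions_of_linearIndependent hL hn (v := v) ?_ fun i => ?_⟩
  · exact LinearIndependent.of_comp (N.val.toLinearMap.restrictScalars (constants K))
      (linearIndependent_constants_iff.mpr hf)
  · apply (algebraMap N Ω).injective
    rw [← DiffOp.apply_algebraMap, map_zero, hLp, DiffOp.comp_apply]
    change DiffOp.apply _ (DiffOp.apply _ (f i)) = 0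
    rw [hfs', DiffOp.apply_zero]

end Construction

end DiffField

theorem mainTheorem1 {K : Type u} [Field K] [CharZero K] [Differential K]
    (n : ℕ) (L : DiffField.DiffOp K) (hL : L.degree = n) :
    (∃ (E : Type u) (_ : Field E) (_ : Differential E) (_ : Algebra K E)
        (_ : DifferentialAlgebra K E) (_ : Differential.ContainConstants K E),
        DiffField.IsAdmissible K E ∧ DiffField.ContainsAllSolutions E n L) ↔
    (∃ (F : Type u) (_ : Field F) (_ : Differential F) (_ : Algebra K F)
        (_ : DifferentialAlgebra K F) (_ : Differential.ContainConstants K F)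
        (p : Fin n → K) (z : Fin n → Fˣ),
        (∀ i, ((z i : F))′ = algebraMap K F (p i) * (z i : F)) ∧
        L = DiffField.DiffOp.comp (C (L.coeff n)) (DiffField.DiffOp.prodLinear p) ∧
        DiffField.TorsionFreeModBase (K := K) z) := by
  have hL0 : L ≠ 0 := by
    rintro rfl
    simp at hL
  have hn : L.natDegree = n := natDegree_eq_of_degree_eq_some hL
  constructor
  · rintro ⟨E, _, _, _, _, _, hE, ⟨v, hv, hs⟩, -⟩
    obtain ⟨p, z, hz, hzp, hLp⟩ := hE.exists_factorization n L hL0 hn v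
      (DiffField.linearIndependent_constants_iff.mp hv) hs
    refine ⟨E, inferInstance, inferInstance, inferInstance, inferInstance, inferInstance, p,
      fun i => Units.mk0 (z i) (hz i), hzp, ?_, ?_⟩
    · rwa [leadingCoeff, hn] at hLp
    · exact DiffField.torsionFreeModBase_of_radicallyClosed
        (fun z k hk a h => hE.mem_range_of_pow_eq hk a.ne_zero h) _
  · rintro ⟨F, _, _, _, _, _, p, z, hz, hLp, htf⟩
    exact DiffField.exists_admissible_of_factorization hL0 hn p z hz hLp htf
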